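/- Let $k$ be a field of characteristic zero. For a $\mathbb{Z}$-graded $k$-vector space $\mathcal{H}=\bigoplus_{i\in\mathbb{Z}}\mathcal{H}^i$ let $C(\mathcal{H})=\bigoplus_{n\ge 0}\mathcal{H}^{\otimes n}$ be the tensor coalgebra with the coproduct $\triangle(o_1\cdots o_n)=\sum_{j=0}^{n}(o_1\cdots o_j)\otimes(o_{j+1}\cdots o_n)$ and the counit given by the projection to $\mathcal{H}^{\otimes 0}=k$, graded by total degree. An $A_\infty$-algebra $(\mathcal{H},\mathfrak{m})$ is a graded vector space $\mathcal{H}$ with a linear map $\mathfrak{m}:C(\mathcal{H})\to C(\mathcal{H})$ of degree one that is a coderivation, $\triangle\mathfrak{m}=(\mathfrak{m}\otimes 1+1\otimes\mathfrak{m})\triangle$ with $(1\otimes\mathfrak{m})(x\otimes y)=(-1)^{\deg x}x\otimes\mathfrak{m}(y)$, and satisfies $\mathfrak{m}^2=0$ and $m_0=0$; here $m_n:\mathcal{H}^{\otimes n}\to\mathcal{H}$ is the $\mathcal{H}$-component of the restriction of $\mathfrak{m}$ to $\mathcal{H}^{\otimes n}$. An $A_\infty$-morphism $\mathcal{F}:(\mathcal{H},\mathfrak{m})\to(\mathcal{H}',\mathfrak{m}')$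 is a homomorphism of counital coalgebras $\mathcal{F}:C(\mathcal{H})\to C(\mathcal{H}')$ of degree zero with $\mathcal{F}\mathfrak{m}=\mathfrak{m}'\mathcal{F}$ and $f_0=0$, where $f_n:\mathcal{H}^{\otimes n}\to\mathcal{H}'$ is the $\mathcal{H}'$-component of the restriction of $\mathcal{F}$ to $\mathcal{H}^{\otimes n}$. Then $m_1^2=0$ and $f_1$ is a chain map $(\mathcal{H},m_1)\to(\mathcal{H}',m_1')$; $\mathcal{F}$ is an $A_\infty$-quasi-isomorphism if the induced map $H(f_1):H_{m_1}(\mathcal{H})\to H_{m_1'}(\mathcal{H}')$ on cohomology is an isomorphism. **Theorem (existence of the inverse quasi-isomorphism).** Let $(\mathcal{H},\mathfrak{m})$ and $(\mathcal{H}',\mathfrak{m}')$ be $A_\infty$-algebras over $k$ and let $\mathcal{F}:(\mathcal{H},\mathfrak{m})\to(\mathcal{H}',\mathfrak{m}')$ be an $A_\infty$-quasi-isomorphism. Then there exists an inverse $A_\infty$-quasi-isomorphism, that is, an $A_\infty$-quasi-isomorphism $\mathcal{G}:(\mathcal{H}',\mathfrak{m}')\to(\mathcal{H},\mathfrak{m})$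 such that $H(g_1)$ is the two-sided inverse of $H(f_1)$ on cohomology. -/

import Mathlib

open scoped TensorProduct

noncomputable section

namespace AInfty

section TensorCoalgebra

variable (k : Type*) [Field k] (H : Type*) [AddCommGroup H] [Module k H]

/-- The underlying space `⨁ n ≥ 0, H^{⊗ n}` of the tensor coalgebra of `H`.  Only its vector space
structure and the words `o₁ ⋯ oₙ` (products of letters `ι o`) are used; as a coalgebra it carries the
deconcatenation coproduct `deconc`. -/
abbrev Bar : Type _ := TensorAlgebra k H

/-- The operator `(w, d) ↦ (x w, 1 ⊗ x w + (x ⊗ 1) d)`, linear in `x : H`.  It encodes the recursion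
`Δ (x w) = 1 ⊗ x w + (x ⊗ 1) Δ w`. -/
def deconcStep :
    H →ₗ[k] Module.End k (Bar k H × (Bar k H ⊗[k] Bar k H)) where
  toFun x :=
    LinearMap.prod
      (LinearMap.mulLeft k (TensorAlgebra.ι k x) ∘ₗ LinearMap.fst k _ _)
      (TensorProduct.mk k (Bar k H) (Bar k H) 1 ∘ₗ
          LinearMap.mulLeft k (TensorAlgebra.ι k x) ∘ₗ LinearMap.fst k _ _ +
        LinearMap.rTensor (Bar k H) (LinearMap.mulLeft k (TensorAlgebra.ι k x)) ∘ₗ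
          LinearMap.snd k _ _)
  map_add' x y := by
    refine LinearMap.ext fun p => Prod.ext ?_ ?_
    · simp [add_mul]
    · simp only [map_add, LinearMap.prod_apply, Function.prod_apply, LinearMap.add_apply,
        LinearMap.comp_apply, LinearMap.fst_apply, LinearMap.snd_apply, LinearMap.mulLeft_apply,
        add_mul, Prod.snd_add, TensorProduct.mk_apply]
      rw [show LinearMap.mulLeft k (TensorAlgebra.ι k x + TensorAlgebra.ι k y) =
        LinearMap.mulLeft k (TensorAlgebra.ι k x) + LinearMap.mulLeft k (TensorAlgebra.ι k y) from
          LinearMap.ext fun w => by simp [add_mul], LinearMap.rTensor_add, LinearMap.add_apply]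
      abel
  map_smul' c x := by
    refine LinearMap.ext fun p => Prod.ext ?_ ?_
    · simp
    · simp only [map_smul, LinearMap.prod_apply, Function.prod_apply, LinearMap.add_apply,
        LinearMap.comp_apply, LinearMap.fst_apply, LinearMap.snd_apply, LinearMap.mulLeft_apply,
        LinearMap.smul_apply, Prod.smul_snd, smul_mul_assoc, TensorProduct.mk_apply,
        RingHom.id_apply, smul_add]
      rw [show LinearMap.mulLeft k (c • TensorAlgebra.ι k x) =
        c • LinearMap.mulLeft k (TensorAlgebra.ι k x) from
          LinearMap.ext fun w => by simp, LinearMap.rTensor_smul, LinearMap.smul_apply]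

/-- The deconcatenation coproduct
`Δ (o₁ ⋯ oₙ) = ∑_{j = 0}^{n} (o₁ ⋯ oⱼ) ⊗ (oⱼ₊₁ ⋯ oₙ)`; see `deconc_word`. -/
def deconc : Bar k H →ₗ[k] Bar k H ⊗[k] Bar k H :=
  LinearMap.snd k _ _ ∘ₗ LinearMap.applyₗ ((1 : Bar k H), (1 : Bar k H) ⊗ₜ[k] (1 : Bar k H)) ∘ₗ
    (TensorAlgebra.lift k (deconcStep k H)).toLinearMap

/-- The counit: the projection of `⨁ n ≥ 0, H^{⊗ n}` to `H^{⊗ 0} = k`. -/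
def counit : Bar k H →ₗ[k] k := (TensorAlgebra.algebraMapInv (R := k) (M := H)).toLinearMap

/-- The projection of `⨁ n ≥ 0, H^{⊗ n}` to `H^{⊗ 1} = H`. -/
def proj : Bar k H →ₗ[k] H := TensorAlgebra.ιInv

variable {k H}

theorem deconc_one : deconc k H 1 = 1 ⊗ₜ 1 := by
  simp [deconc]

theorem lift_deconcStep_fst (w : Bar k H) (p : Bar k H × (Bar k H ⊗[k] Bar k H)) :
    (TensorAlgebra.lift k (deconcStep k H) w p).1 = w * p.1 := by
  induction w using TensorAlgebra.induction generalizing p with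
  | algebraMap r => simp [Algebra.smul_def]
  | ι x => simp [deconcStep]
  | mul a b ha hb => simp [ha, hb, mul_assoc]
  | add a b ha hb => simp [ha, hb, add_mul]

theorem deconc_ι_mul (x : H) (w : Bar k H) :
    deconc k H (TensorAlgebra.ι k x * w) =
      1 ⊗ₜ (TensorAlgebra.ι k x * w) +
        LinearMap.rTensor (Bar k H) (LinearMap.mulLeft k (TensorAlgebra.ι k x)) (deconc k H w) := by
  have h := lift_deconcStep_fst w ((1 : Bar k H), (1 : Bar k H) ⊗ₜ[k] (1 : Bar k H))
  simp only [mul_one] at h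
  have step : ∀ p : Bar k H × (Bar k H ⊗[k] Bar k H), (deconcStep k H x p).2 =
      1 ⊗ₜ (TensorAlgebra.ι k x * p.1) +
        LinearMap.rTensor (Bar k H) (LinearMap.mulLeft k (TensorAlgebra.ι k x)) p.2 :=
    fun p => rfl
  simp only [deconc, LinearMap.comp_apply, AlgHom.toLinearMap_apply, map_mul,
    TensorAlgebra.lift_ι_apply, LinearMap.applyₗ_apply_apply, Module.End.mul_apply,
    LinearMap.snd_apply]
  rw [step, h]

/-- Deconcatenation of a word, in closed form. -/
theorem deconc_word (l : List H) :
    deconc k H (l.map (TensorAlgebra.ι k)).prod =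
      ∑ j ∈ Finset.range (l.length + 1),
        ((l.take j).map (TensorAlgebra.ι k)).prod ⊗ₜ[k] ((l.drop j).map (TensorAlgebra.ι k)).prod := by
  induction l with
  | nil => simp [deconc_one]
  | cons x l ih =>
    rw [List.map_cons, List.prod_cons, deconc_ι_mul, ih, List.length_cons,
      Finset.sum_range_succ' _ (l.length + 1), map_sum, add_comm]
    simp

theorem bar_induction {P : Bar k H → Prop} (one : P 1)
    (add : ∀ a b, P a → P b → P (a + b)) (smul : ∀ (c : k) a, P a → P (c • a))
    (mul : ∀ (x : H) a, P a → P (TensorAlgebra.ι k x * a)) (w : Bar k H) : P w := by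
  suffices h : ∀ w u : Bar k H, P u → P (w * u) by simpa using h w 1 one
  intro w
  induction w using TensorAlgebra.induction with
  | algebraMap r => intro u hu; rw [← Algebra.smul_def]; exact smul r u hu
  | ι x => intro u hu; exact mul x u hu
  | mul a b ha hb => intro u hu; rw [mul_assoc]; exact ha _ (hb _ hu)
  | add a b ha hb => intro u hu; rw [add_mul]; exact add _ _ (ha _ hu) (hb _ hu)

theorem proj_ι (x : H) : proj k H (TensorAlgebra.ι k x) = x := TensorAlgebra.ι_leftInverse x

theorem proj_one : proj k H 1 = 0 := by
  let _ : Module kᵐᵒᵖ H := Module.compHom _ ((RingHom.id k).fromOpposite mul_comm)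
  have _ : IsCentralScalar k H := ⟨fun r m => rfl⟩
  change (TensorAlgebra.toTrivSqZeroExt (1 : Bar k H)).snd = _
  rw [map_one, TrivSqZeroExt.snd_one]

theorem proj_ι_mul (x : H) (w : Bar k H) :
    proj k H (TensorAlgebra.ι k x * w) = counit k H w • x := by
  let _ : Module kᵐᵒᵖ H := Module.compHom _ ((RingHom.id k).fromOpposite mul_comm)
  have _ : IsCentralScalar k H := ⟨fun r m => rfl⟩
  have h : ∀ w : Bar k H, (TensorAlgebra.toTrivSqZeroExt w).fst = counit k H w := by
    intro w
    induction w using bar_induction with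
    | one => simp [counit]
    | add a b ha hb => simp [ha, hb]
    | smul c a ha => simp [ha]
    | mul x a ha => simp [counit, TensorAlgebra.algebraMapInv]
  change (TensorAlgebra.toTrivSqZeroExt (TensorAlgebra.ι k x * w)).snd = _
  rw [map_mul, TrivSqZeroExt.snd_mul, h, h]
  simp [counit, TensorAlgebra.algebraMapInv]

theorem counit_one : counit k H 1 = 1 := by simp [counit]

theorem counit_ι_mul (x : H) (w : Bar k H) : counit k H (TensorAlgebra.ι k x * w) = 0 := by
  simp [counit, TensorAlgebra.algebraMapInv]

/-- The left counit law `(ε ⊗ 1) Δ = 1`. -/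
theorem counit_deconc (w : Bar k H) :
    TensorProduct.lift (LinearMap.lsmul k (Bar k H) ∘ₗ counit k H) (deconc k H w) = w := by
  induction w using bar_induction with
  | one => simp [deconc_one, counit_one]
  | add a b ha hb => rw [map_add, map_add, ha, hb]
  | smul c a ha => rw [map_smul, map_smul, ha]
  | mul x a _ =>
    have h : ∀ t : Bar k H ⊗[k] Bar k H,
        TensorProduct.lift (LinearMap.lsmul k (Bar k H) ∘ₗ counit k H)
          (LinearMap.rTensor (Bar k H) (LinearMap.mulLeft k (TensorAlgebra.ι k x)) t) = 0 := by
      intro t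
      induction t using TensorProduct.induction_on with
      | zero => simp
      | tmul u v => simp [counit_ι_mul]
      | add s t hs ht => rw [map_add, map_add, hs, ht, add_zero]
    rw [deconc_ι_mul, map_add, h]
    simp [counit_one]

/-- Splitting off the first letter of a word and putting it back. -/
def firstLetter : Bar k H ⊗[k] Bar k H →ₗ[k] Bar k H :=
  TensorProduct.lift (LinearMap.mul k (Bar k H) ∘ₗ TensorAlgebra.ι k ∘ₗ proj k H)

theorem firstLetter_tmul (u v : Bar k H) :
    firstLetter (u ⊗ₜ v) = TensorAlgebra.ι k (proj k H u) * v := by simp [firstLetter]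

theorem firstLetter_deconc (w : Bar k H) :
    firstLetter (deconc k H w) = w - algebraMap k (Bar k H) (counit k H w) := by
  induction w using bar_induction with
  | one => simp [deconc_one, firstLetter_tmul, proj_one, counit_one]
  | add a b ha hb => rw [map_add, map_add, ha, hb, map_add, map_add]; abel
  | smul c a ha =>
    rw [map_smul, map_smul, ha, map_smul, smul_sub, smul_eq_mul, map_mul, Algebra.smul_def c
      (algebraMap k (Bar k H) _)]
  | mul x a _ =>
    have h : ∀ t : Bar k H ⊗[k] Bar k H,
        firstLetter (LinearMap.rTensor (Bar k H) (LinearMap.mulLeft k (TensorAlgebra.ι k x)) t) =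
          TensorAlgebra.ι k x *
            TensorProduct.lift (LinearMap.lsmul k (Bar k H) ∘ₗ counit k H) t := by
      intro t
      induction t using TensorProduct.induction_on with
      | zero => simp
      | tmul u v => simp [firstLetter_tmul, proj_ι_mul]
      | add s t hs ht => rw [map_add, map_add, hs, ht, map_add, mul_add]
    rw [deconc_ι_mul, map_add, h, counit_deconc, firstLetter_tmul, proj_one, counit_ι_mul]
    simp

theorem deconc_ι (x : H) :
    deconc k H (TensorAlgebra.ι k x) =
      1 ⊗ₜ TensorAlgebra.ι k x + TensorAlgebra.ι k x ⊗ₜ 1 := by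
  have h := deconc_ι_mul (k := k) x 1
  simpa [deconc_one] using h

/-- A primitive element of the tensor coalgebra is a letter. -/
theorem eq_ι_of_primitive {w : Bar k H} (hw : deconc k H w = w ⊗ₜ 1 + 1 ⊗ₜ w) :
    w = TensorAlgebra.ι k (proj k H w) := by
  have h := firstLetter_deconc w
  have h2 := counit_deconc w
  rw [hw, map_add, firstLetter_tmul, firstLetter_tmul, proj_one] at h
  rw [hw] at h2
  have h3 : algebraMap k (Bar k H) (counit k H w) = 0 := by
    simpa [counit_one, Algebra.smul_def] using h2
  rw [h3] at h
  simpa using h.symm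

end TensorCoalgebra

section Components

variable {k : Type*} [Field k] {H : Type*} [AddCommGroup H] [Module k H]
  {H' : Type*} [AddCommGroup H'] [Module k H']

/-- The multilinear map `φₙ : H^{⊗ n} → H'` carried by a linear map `φ` of tensor coalgebras: the
`H'`-component of the restriction of `φ` to `H^{⊗ n}`. -/
def component (φ : Bar k H →ₗ[k] Bar k H') (n : ℕ) :
    MultilinearMap k (fun _ : Fin n => H) H' :=
  (proj k H' ∘ₗ φ).compMultilinearMap (TensorAlgebra.tprod k H n)

/-- The component `φ₁ : H → H'`, as a linear map. -/
def linearPart (φ : Bar k H →ₗ[k] Bar k H') : H →ₗ[k] H' :=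
  proj k H' ∘ₗ φ ∘ₗ TensorAlgebra.ι k

theorem component_one (φ : Bar k H →ₗ[k] Bar k H') (v : Fin 1 → H) :
    component φ 1 v = linearPart φ (v 0) := by
  simp [component, linearPart, TensorAlgebra.tprod_apply]

theorem proj_one_of_component_zero {φ : Bar k H →ₗ[k] Bar k H'} (h : component φ 0 = 0) :
    proj k H' (φ 1) = 0 := by
  have := congrArg (fun f => f (0 : Fin 0 → H)) h
  simpa [component, TensorAlgebra.tprod_apply] using this

end Components

section Grading

variable {k : Type*} [Field k] {H : Type*} [AddCommGroup H] [Module k H]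
  (ℋ : ℤ → Submodule k H)

/-- The degree `d` part of the tensor coalgebra of the graded vector space `H = ⨁ i, ℋ i`, spanned by
the words `o₁ ⋯ oₙ` in homogeneous letters whose degrees add up to `d`. -/
def barDegree (d : ℤ) : Submodule k (Bar k H) :=
  Submodule.span k {w | ∃ l : List (Σ i, ℋ i),
    (l.map Sigma.fst).sum = d ∧ w = (l.map fun o => TensorAlgebra.ι k (o.2 : H)).prod}

variable [DirectSum.Decomposition ℋ]

/-- The linear map `o ↦ (-1)^{deg o} o` of `H`. -/
def letterSign : H →ₗ[k] H :=
  DirectSum.toModule k ℤ H (fun i => ((i.negOnePow : ℤ) : k) • (ℋ i).subtype) ∘ₗ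
    (DirectSum.decomposeLinearEquiv ℋ).toLinearMap

/-- The linear map `w ↦ (-1)^{deg w} w` of the tensor coalgebra. -/
def barSign : Bar k H →ₗ[k] Bar k H :=
  (TensorAlgebra.lift k (TensorAlgebra.ι k ∘ₗ letterSign ℋ)).toLinearMap

theorem letterSign_apply {i : ℤ} {x : H} (hx : x ∈ ℋ i) :
    letterSign ℋ x = ((i.negOnePow : ℤ) : k) • x := by
  simp [letterSign, DirectSum.decomposeLinearEquiv_apply, DirectSum.decompose_of_mem ℋ hx,
    ← DirectSum.lof_eq_of k]

theorem barSign_apply {d : ℤ} {w : Bar k H} (hw : w ∈ barDegree ℋ d) :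
    barSign ℋ w = ((d.negOnePow : ℤ) : k) • w := by
  induction hw using Submodule.span_induction with
  | mem w hw =>
    obtain ⟨l, rfl, rfl⟩ := hw
    induction l with
    | nil => simp [barSign]
    | cons o l ih =>
      simp only [barSign, AlgHom.toLinearMap_apply] at ih
      simp only [barSign, AlgHom.toLinearMap_apply, List.map_cons, List.prod_cons, map_mul, ih,
        TensorAlgebra.lift_ι_apply, LinearMap.comp_apply, letterSign_apply ℋ o.2.2, List.sum_cons, Int.negOnePow_add,
        map_smul]
      rw [smul_mul_smul_comm]
      simp
  | zero => simp
  | add a b _ _ ha hb => simp [ha, hb]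
  | smul c a _ ha => rw [map_smul, ha, smul_comm]

end Grading

section Definitions

variable {k : Type*} [Field k] {H : Type*} [AddCommGroup H] [Module k H]
  {H' : Type*} [AddCommGroup H'] [Module k H']

/-- An `A∞`-structure on the graded vector space `H = ⨁ i, ℋ i`: a coderivation `𝔪` of degree one on
the tensor coalgebra with `𝔪² = 0` and `m₀ = 0`.  The coderivation rule is
`Δ 𝔪 = (𝔪 ⊗ 1) Δ + (1 ⊗ 𝔪) Δ` with `(1 ⊗ 𝔪) (x ⊗ y) = (-1)^{deg x} x ⊗ 𝔪 y`. -/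
structure AInftyAlgebra (ℋ : ℤ → Submodule k H) [DirectSum.Decomposition ℋ] where
  m : Bar k H →ₗ[k] Bar k H
  degree_one : ∀ d : ℤ, ∀ w ∈ barDegree ℋ d, m w ∈ barDegree ℋ (d + 1)
  coderivation : deconc k H ∘ₗ m =
    TensorProduct.map m LinearMap.id ∘ₗ deconc k H +
      TensorProduct.map (barSign ℋ) m ∘ₗ deconc k H
  sq_zero : m ∘ₗ m = 0
  m_zero : component m 0 = 0

variable {ℋ : ℤ → Submodule k H} [DirectSum.Decomposition ℋ]
  {ℋ' : ℤ → Submodule k H'} [DirectSum.Decomposition ℋ']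

/-- An `A∞`-morphism: a degree zero homomorphism `F` of (counital) tensor coalgebras with
`F 𝔪 = 𝔪' F` and `f₀ = 0`. -/
structure AInftyMorphism (A : AInftyAlgebra ℋ) (A' : AInftyAlgebra ℋ') where
  F : Bar k H →ₗ[k] Bar k H'
  degree_zero : ∀ d : ℤ, ∀ w ∈ barDegree ℋ d, F w ∈ barDegree ℋ' d
  comul_comp : deconc k H' ∘ₗ F = TensorProduct.map F F ∘ₗ deconc k H
  counit_comp : AInfty.counit k H' ∘ₗ F = counit k H
  comm : F ∘ₗ A.m = A'.m ∘ₗ F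
  f_zero : component F 0 = 0

namespace AInftyAlgebra

variable (A : AInftyAlgebra ℋ)

/-- The differential `m₁ : H → H`. -/
def m₁ : H →ₗ[k] H := linearPart A.m

theorem m_one : A.m 1 = 0 := by
  have h := LinearMap.congr_fun A.coderivation 1
  have h1 : barSign ℋ (1 : Bar k H) = 1 := by simp [barSign]
  simp only [LinearMap.comp_apply, LinearMap.add_apply, deconc_one, TensorProduct.map_tmul,
    LinearMap.id_apply, h1] at h
  rw [eq_ι_of_primitive h, proj_one_of_component_zero A.m_zero, map_zero]

theorem m_ι (x : H) : A.m (TensorAlgebra.ι k x) = TensorAlgebra.ι k (A.m₁ x) := by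
  refine eq_ι_of_primitive ?_
  have h := LinearMap.congr_fun A.coderivation (TensorAlgebra.ι k x)
  have h1 : barSign ℋ (1 : Bar k H) = 1 := by simp [barSign]
  simpa [deconc_ι, h1, m_one] using h

theorem m₁_m₁ (x : H) : A.m₁ (A.m₁ x) = 0 := by
  have h := LinearMap.congr_fun A.sq_zero (TensorAlgebra.ι k x)
  rw [LinearMap.comp_apply, m_ι, m_ι] at h
  simpa using h

/-- The cohomology `ker m₁ / im m₁` of the complex `(H, m₁)`. -/
abbrev Cohomology : Type _ :=
  LinearMap.ker A.m₁ ⧸ (LinearMap.range A.m₁).submoduleOf (LinearMap.ker A.m₁)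

end AInftyAlgebra

namespace AInftyMorphism

variable {A : AInftyAlgebra ℋ} {A' : AInftyAlgebra ℋ'} (F : AInftyMorphism A A')

/-- The linear map `f₁ : H → H'`. -/
def f₁ : H →ₗ[k] H' := linearPart F.F

theorem F_one : F.F 1 = 1 := by
  have h := LinearMap.congr_fun F.comul_comp 1
  have hc := LinearMap.congr_fun F.counit_comp 1
  have h2 := firstLetter_deconc (F.F 1)
  simp only [LinearMap.comp_apply, deconc_one, TensorProduct.map_tmul] at h
  rw [LinearMap.comp_apply, counit_one] at hc
  rw [h, firstLetter_tmul, proj_one_of_component_zero F.f_zero, hc, map_zero, zero_mul,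
    (algebraMap k (Bar k H')).map_one] at h2
  exact (sub_eq_zero.mp h2.symm)

theorem F_ι (x : H) : F.F (TensorAlgebra.ι k x) = TensorAlgebra.ι k (F.f₁ x) := by
  refine eq_ι_of_primitive ?_
  have h := LinearMap.congr_fun F.comul_comp (TensorAlgebra.ι k x)
  simpa [deconc_ι, F_one, add_comm] using h

/-- `f₁` is a chain map. -/
theorem f₁_m₁ (x : H) : F.f₁ (A.m₁ x) = A'.m₁ (F.f₁ x) := by
  have h := LinearMap.congr_fun F.comm (TensorAlgebra.ι k x)
  rw [LinearMap.comp_apply, LinearMap.comp_apply, A.m_ι, F_ι, F_ι, A'.m_ι] at h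
  exact (TensorAlgebra.ι_inj k _ _).mp h

/-- The restriction of `f₁` to cocycles. -/
def cocycleMap : LinearMap.ker A.m₁ →ₗ[k] LinearMap.ker A'.m₁ :=
  F.f₁.restrict fun x hx => by
    rw [LinearMap.mem_ker] at hx ⊢
    rw [← f₁_m₁, hx, map_zero]

/-- The map induced by `f₁` on cohomology. -/
def cohomologyMap : A.Cohomology →ₗ[k] A'.Cohomology :=
  Submodule.mapQ _ _ F.cocycleMap <| by
    rintro ⟨x, hx⟩ ⟨y, hy⟩
    exact ⟨F.f₁ y, by rw [← f₁_m₁, hy]; rfl⟩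

/-- `F` is an `A∞`-quasi-isomorphism: `f₁` induces an isomorphism on cohomology. -/
def IsQuasiIso : Prop := Function.Bijective F.cohomologyMap

end AInftyMorphism

end Definitions

end AInfty

end

/-!
The inverse `G : C(H') → C(H)` is built together with a homotopy `T` from the identity to `F ∘ G`,
by induction on the length of words. Coalgebra maps and coderivations into a tensor coalgebra are
free on their letter components, so `G` and `T` amount to a single linear map `p` of degree zero
from `C(H')` to the mapping cone of `f₁`. If `G` commutes with the differentials and `T` is a
homotopy on words of length less than `n`, then on words of length `n` the failure of either takes
values in letters, and together these failures form a cocycle with values in the cone. As `f₁` is a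
quasi-isomorphism, the cone has a contraction `s` of degree `-1`, and subtracting from `p` the
composition of `s` with that cocycle makes the two conditions hold on words of length `n` as well.
-/

open WithConv

noncomputable section

namespace AInfty

section Convolution

variable {k : Type*} [Field k] {H : Type*} [AddCommGroup H] [Module k H]
  {H' : Type*} [AddCommGroup H'] [Module k H']
  {A : Type*} [Ring A] [Algebra k A] {B : Type*} [Ring B] [Algebra k B]

theorem rTensor_mulLeft_apply (x : A) (z : A ⊗[k] B) :
    LinearMap.rTensor B (LinearMap.mulLeft k x) z = (x ⊗ₜ 1) * z := by
  induction z using TensorProduct.induction_on with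
  | zero => simp
  | tmul u v => simp
  | add s t hs ht => rw [map_add, mul_add, hs, ht]

theorem deconc_ι_mul' (x : H) (w : Bar k H) :
    deconc k H (TensorAlgebra.ι k x * w) =
      1 ⊗ₜ (TensorAlgebra.ι k x * w) + (TensorAlgebra.ι k x ⊗ₜ 1) * deconc k H w := by
  rw [deconc_ι_mul, rTensor_mulLeft_apply]

theorem bar_hom_ext {M : Type*} [AddCommGroup M] [Module k M] {φ ψ : Bar k H →ₗ[k] M}
    (one : φ 1 = ψ 1)
    (mul : ∀ (x : H) w, φ w = ψ w → φ (TensorAlgebra.ι k x * w) = ψ (TensorAlgebra.ι k x * w)) :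
    φ = ψ :=
  LinearMap.ext fun w => by
    induction w using bar_induction with
    | one => exact one
    | add a b ha hb => rw [map_add, map_add, ha, hb]
    | smul c a ha => rw [map_smul, map_smul, ha]
    | mul x w hw => exact mul x w hw

theorem lTensor_tmul_one_mul {C : Type*} [Ring C] [Algebra k C] (f : B →ₗ[k] C) (x : A)
    (z : A ⊗[k] B) : LinearMap.lTensor A f ((x ⊗ₜ 1) * z) = (x ⊗ₜ 1) * LinearMap.lTensor A f z := by
  induction z using TensorProduct.induction_on with
  | zero => simp
  | tmul u v => simp
  | add s t hs ht => simp only [mul_add, map_add, hs, ht]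

theorem coassoc_rTensor_deconc (x : H) (z : Bar k H ⊗[k] Bar k H) :
    TensorProduct.assoc k _ _ _
        (LinearMap.rTensor _ (deconc k H) ((TensorAlgebra.ι k x ⊗ₜ 1) * z)) =
      1 ⊗ₜ ((TensorAlgebra.ι k x ⊗ₜ 1) * z) +
        (TensorAlgebra.ι k x ⊗ₜ 1) *
          TensorProduct.assoc k _ _ _ (LinearMap.rTensor _ (deconc k H) z) := by
  induction z using TensorProduct.induction_on with
  | zero => simp
  | add s t hs ht => simp only [mul_add, map_add, hs, ht, TensorProduct.tmul_add]; abel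
  | tmul u v =>
    simp only [Algebra.TensorProduct.tmul_mul_tmul, one_mul, LinearMap.rTensor_tmul,
      deconc_ι_mul', TensorProduct.add_tmul, map_add, TensorProduct.assoc_tmul, add_right_inj]
    induction deconc k H u using TensorProduct.induction_on with
    | zero => simp
    | add s t hs ht => simp only [mul_add, map_add, hs, ht, TensorProduct.add_tmul]
    | tmul a b => simp

/-- The tensor coalgebra, with deconcatenation as coproduct: the coalgebra structure behind the
convolution product of linear maps out of `Bar k H`. -/
instance : Coalgebra k (Bar k H) where
  comul := deconc k H
  counit := counit k H
  coassoc := by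
    refine bar_hom_ext (by simp [deconc_one]) fun x w hw => ?_
    simp only [LinearMap.comp_apply, LinearEquiv.coe_coe] at hw ⊢
    rw [deconc_ι_mul', map_add, map_add, map_add, coassoc_rTensor_deconc, hw,
      lTensor_tmul_one_mul, LinearMap.rTensor_tmul, LinearMap.lTensor_tmul, deconc_one,
      TensorProduct.assoc_tmul, deconc_ι_mul', TensorProduct.tmul_add, add_assoc]
  rTensor_counit_comp_comul := by
    refine bar_hom_ext (by simp [deconc_one, counit_one]) fun x w _ => ?_
    have hl (z : Bar k H ⊗[k] Bar k H) :
        LinearMap.rTensor _ (counit k H) ((TensorAlgebra.ι k x ⊗ₜ 1) * z) = 0 := by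
      induction z using TensorProduct.induction_on with
      | zero => simp
      | add s t hs ht => simp only [mul_add, map_add, hs, ht, add_zero]
      | tmul u v => simp [counit_ι_mul]
    simp [deconc_ι_mul', hl, counit_one]
  lTensor_counit_comp_comul := by
    refine bar_hom_ext (by simp [deconc_one, counit_one]) fun x w hw => ?_
    simp only [LinearMap.comp_apply] at hw ⊢
    rw [deconc_ι_mul', map_add, lTensor_tmul_one_mul, hw]
    simp [counit_ι_mul]

theorem comul_eq_deconc : CoalgebraStruct.comul (R := k) (A := Bar k H) = deconc k H := rfl

theorem coalgebra_counit_eq : CoalgebraStruct.counit (R := k) (A := Bar k H) = counit k H := rfl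

/-- Linear maps from the tensor coalgebra to an algebra, as a ring under convolution. -/
abbrev Conv (k : Type*) [Field k] (H : Type*) [AddCommGroup H] [Module k H] (A : Type*) [Ring A]
    [Algebra k A] : Type _ := WithConv (Bar k H →ₗ[k] A)

/-- Postcomposition with an algebra homomorphism, as a homomorphism of convolution rings. -/
def Conv.map (h : A →ₐ[k] B) : Conv k H A →+* Conv k H B where
  toFun φ := toConv (h.toLinearMap ∘ₗ φ.ofConv)
  map_one' := by ext w; simp
  map_mul' φ ψ := congrArg toConv (LinearMap.algHom_comp_convMul_distrib h φ ψ)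
  map_zero' := by simp
  map_add' φ ψ := by ext; simp

theorem Conv.map_apply (h : A →ₐ[k] B) (φ : Conv k H A) (w : Bar k H) :
    (Conv.map h φ).ofConv w = h (φ.ofConv w) := rfl

/-- `φ ⊗ 1` as an element of a convolution ring. -/
abbrev inl (φ : Conv k H A) : Conv k H (A ⊗[k] B) :=
  Conv.map Algebra.TensorProduct.includeLeft φ

/-- `1 ⊗ φ` as an element of a convolution ring. -/
abbrev inr (φ : Conv k H B) : Conv k H (A ⊗[k] B) :=
  Conv.map Algebra.TensorProduct.includeRight φ

theorem map_deconc (φ : Bar k H →ₗ[k] A) (ψ : Bar k H →ₗ[k] B) :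
    toConv (TensorProduct.map φ ψ ∘ₗ deconc k H) = inl (toConv φ) * inr (toConv ψ) := by
  rw [LinearMap.convMul_def, ← comul_eq_deconc, ← LinearMap.comp_assoc]
  congr 2
  ext
  simp [Conv.map_apply]

theorem convMul_eq (φ ψ : Conv k H A) :
    φ * ψ = toConv (LinearMap.mul' k A ∘ₗ TensorProduct.map φ.ofConv ψ.ofConv ∘ₗ deconc k H) := rfl

theorem convMul_word (φ ψ : Conv k H A) (l : List H) :
    (φ * ψ).ofConv (l.map (TensorAlgebra.ι k)).prod = ∑ j ∈ Finset.range (l.length + 1),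
      φ.ofConv ((l.take j).map (TensorAlgebra.ι k)).prod *
        ψ.ofConv ((l.drop j).map (TensorAlgebra.ι k)).prod := by
  simp [comul_eq_deconc, deconc_word]

theorem convMul_one (φ ψ : Conv k H A) : (φ * ψ).ofConv 1 = φ.ofConv 1 * ψ.ofConv 1 := by
  simpa using convMul_word φ ψ []

/-- The linear map `a : C(H) → H'` as a map to the letters of `C(H')`. -/
def letters (a : Bar k H →ₗ[k] H') : Conv k H (Bar k H') := toConv (TensorAlgebra.ι k ∘ₗ a)

theorem deconc_letters_mul (a : Bar k H →ₗ[k] H') (φ : Conv k H (Bar k H')) :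
    toConv (deconc k H' ∘ₗ (letters a * φ).ofConv) =
      inr (letters a * φ) + inl (letters a) * toConv (deconc k H' ∘ₗ φ.ofConv) := by
  ext w
  simp only [ofConv_add, LinearMap.add_apply, Conv.map_apply, LinearMap.comp_apply]
  simp only [convMul_eq, letters, LinearMap.comp_apply]
  induction deconc k H w using TensorProduct.induction_on with
  | zero => simp
  | tmul u v => simp [deconc_ι_mul', Conv.map_apply]
  | add s t hs ht => simp only [map_add, hs, ht]; abel

theorem firstLetter_inl_mul_inr (φ ψ : Bar k H →ₗ[k] Bar k H') :
    toConv (firstLetter ∘ₗ (inl (toConv φ) * inr (toConv ψ)).ofConv) =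
      letters (proj k H' ∘ₗ φ) * toConv ψ := by
  rw [← map_deconc, convMul_eq, ← LinearMap.comp_assoc, ← LinearMap.comp_assoc]
  congr 2
  ext
  simp [letters, firstLetter_tmul]

end Convolution

section Length

variable {k : Type*} [Field k] {H : Type*} [AddCommGroup H] [Module k H]
  {H' : Type*} [AddCommGroup H'] [Module k H'] {A : Type*} [Ring A] [Algebra k A]
  {M : Type*} [AddCommGroup M] [Module k M] {N : Type*} [AddCommGroup N] [Module k N]

variable (k H) in
/-- The span of the words of length less than `n`. -/
def lengthLT (n : ℕ) : Submodule k (Bar k H) :=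
  Submodule.span k {w | ∃ l : List H, l.length < n ∧ w = (l.map (TensorAlgebra.ι k)).prod}

theorem word_mem_lengthLT {l : List H} {n : ℕ} (h : l.length < n) :
    (l.map (TensorAlgebra.ι k)).prod ∈ lengthLT k H n :=
  Submodule.subset_span ⟨l, h, rfl⟩

theorem lengthLT_le {n : ℕ} {P : Submodule k (Bar k H)} :
    lengthLT k H n ≤ P ↔ ∀ l : List H, l.length < n → (l.map (TensorAlgebra.ι k)).prod ∈ P :=
  Submodule.span_le.trans ⟨fun h l hl => h ⟨l, hl, rfl⟩, fun h _ ⟨l, hl, hw⟩ => hw ▸ h l hl⟩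

theorem lengthLT_mono {m n : ℕ} (h : m ≤ n) : lengthLT k H m ≤ lengthLT k H n :=
  lengthLT_le.mpr fun _ hl => word_mem_lengthLT (hl.trans_le h)

theorem mul_mem_lengthLT {m n : ℕ} {v w : Bar k H} (hv : v ∈ lengthLT k H (m + 1))
    (hw : w ∈ lengthLT k H n) : v * w ∈ lengthLT k H (m + n) := by
  suffices lengthLT k H (m + 1) ≤ (lengthLT k H (m + n)).comap (LinearMap.mulRight k w) from
    this hv
  refine lengthLT_le.mpr fun l hl => ?_
  suffices lengthLT k H n ≤ (lengthLT k H (m + n)).comap (LinearMap.mulLeft k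
    (l.map (TensorAlgebra.ι k)).prod) from this hw
  refine lengthLT_le.mpr fun l' hl' => ?_
  simpa using word_mem_lengthLT (k := k) (l := l ++ l') (n := m + n) (by simp; omega)

theorem ι_mem_lengthLT (x : H) : TensorAlgebra.ι k x ∈ lengthLT k H 2 := by
  simpa using word_mem_lengthLT (k := k) (l := [x]) one_lt_two

theorem exists_mem_lengthLT (w : Bar k H) : ∃ n, w ∈ lengthLT k H n := by
  induction w using bar_induction with
  | one => exact ⟨1, word_mem_lengthLT (l := []) one_pos⟩
  | add a b ha hb =>
    obtain ⟨m, hm⟩ := ha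
    obtain ⟨n, hn⟩ := hb
    exact ⟨max m n, add_mem (lengthLT_mono (le_max_left _ _) hm)
      (lengthLT_mono (le_max_right _ _) hn)⟩
  | smul c a ha => exact ha.imp fun n hn => Submodule.smul_mem _ _ hn
  | mul x w hw => exact hw.elim fun n hn => ⟨1 + n, mul_mem_lengthLT (ι_mem_lengthLT x) hn⟩

theorem exists_limit_of_stable (g : ℕ → Bar k H →ₗ[k] M)
    (hg : ∀ n, ∀ w ∈ lengthLT k H n, g (n + 1) w = g n w) :
    ∃ g' : Bar k H →ₗ[k] M, ∀ n, ∀ w ∈ lengthLT k H n, g' w = g n w := by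
  have stable (n p : ℕ) : ∀ w ∈ lengthLT k H n, g (n + p) w = g n w := by
    intro w hw
    induction p with
    | zero => rfl
    | succ p ih => rw [← add_assoc, hg _ _ (lengthLT_mono (Nat.le_add_right n p) hw), ih]
  have agree (m n : ℕ) (w) (hm : w ∈ lengthLT k H m) (hn : w ∈ lengthLT k H n) :
      g m w = g n w := by
    rw [← stable m n w hm, ← stable n m w hn, add_comm]
  choose N hN using exists_mem_lengthLT (k := k) (H := H)
  refine ⟨⟨⟨fun w => g (N w) w, fun v w => ?_⟩, fun c w => ?_⟩,
    fun n w hw => agree _ _ w (hN w) hw⟩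
  · have hv := lengthLT_mono (le_max_left (N v) (N w)) (hN v)
    have hw := lengthLT_mono (le_max_right (N v) (N w)) (hN w)
    rw [agree _ _ _ (hN v) hv, agree _ _ _ (hN w) hw, agree _ _ _ (hN (v + w)) (add_mem hv hw),
      map_add]
  · exact (agree _ _ _ (hN (c • w)) (Submodule.smul_mem _ c (hN w))).trans (map_smul _ c w)

/-- The linear maps vanishing on all words of length less than `n`. -/
def vanishing (k : Type*) [Field k] (H : Type*) [AddCommGroup H] [Module k H]
    (M : Type*) [AddCommGroup M] [Module k M] (n : ℕ) : Submodule k (Bar k H →ₗ[k] M) where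
  carrier := {φ | ∀ w ∈ lengthLT k H n, φ w = 0}
  zero_mem' _ _ := rfl
  add_mem' hφ hψ w hw := by rw [LinearMap.add_apply, hφ w hw, hψ w hw, add_zero]
  smul_mem' c φ hφ w hw := by rw [LinearMap.smul_apply, hφ w hw, smul_zero]

theorem mem_vanishing_iff_word {φ : Bar k H →ₗ[k] M} {n : ℕ} :
    φ ∈ vanishing k H M n ↔
      ∀ l : List H, l.length < n → φ (l.map (TensorAlgebra.ι k)).prod = 0 :=
  lengthLT_le (P := LinearMap.ker φ)

theorem mem_vanishing_zero (φ : Bar k H →ₗ[k] M) : φ ∈ vanishing k H M 0 :=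
  mem_vanishing_iff_word.mpr fun _ h => absurd h (Nat.not_lt_zero _)

theorem mem_vanishing_one {φ : Bar k H →ₗ[k] M} (h : φ 1 = 0) : φ ∈ vanishing k H M 1 :=
  mem_vanishing_iff_word.mpr fun l hl => by
    rw [List.length_eq_zero_iff.mp (Nat.lt_one_iff.mp hl)]
    exact h

theorem vanishing_antitone : Antitone (vanishing k H M) :=
  fun _ _ h _ hφ w hw => hφ w (lengthLT_mono h hw)

theorem eq_zero_of_forall_mem_vanishing {φ : Bar k H →ₗ[k] M}
    (h : ∀ n, φ ∈ vanishing k H M n) : φ = 0 :=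
  LinearMap.ext fun w => (exists_mem_lengthLT w).elim fun n hw => h n w hw

theorem eq_of_forall_sub_mem_vanishing {φ ψ : Conv k H A}
    (h : ∀ n, (φ - ψ).ofConv ∈ vanishing k H A n) : φ = ψ :=
  sub_eq_zero.mp (congrArg toConv (eq_zero_of_forall_mem_vanishing h))

theorem comp_mem_vanishing (f : M →ₗ[k] N) {φ : Bar k H →ₗ[k] M} {n : ℕ}
    (h : φ ∈ vanishing k H M n) : f ∘ₗ φ ∈ vanishing k H N n :=
  fun w hw => by rw [LinearMap.comp_apply, h w hw, map_zero]

theorem mul_mem_vanishing {φ ψ : Conv k H A} {m n : ℕ} (hφ : φ.ofConv ∈ vanishing k H A m)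
    (hψ : ψ.ofConv ∈ vanishing k H A n) : (φ * ψ).ofConv ∈ vanishing k H A (m + n) :=
  mem_vanishing_iff_word.mpr fun l hl => by
    rw [convMul_word]
    refine Finset.sum_eq_zero fun j _ => ?_
    by_cases hj : (l.take j).length < m
    · exact mul_eq_zero_of_left (hφ _ (word_mem_lengthLT hj)) _
    · refine mul_eq_zero_of_right _ (hψ _ (word_mem_lengthLT ?_))
      simp only [List.length_take, List.length_drop] at hj ⊢
      omega

theorem mul_mem_vanishing_left {φ : Conv k H A} {n : ℕ} (hφ : φ.ofConv ∈ vanishing k H A n)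
    (ψ : Conv k H A) : (φ * ψ).ofConv ∈ vanishing k H A n := by
  simpa using mul_mem_vanishing hφ (mem_vanishing_zero ψ.ofConv)

theorem mul_mem_vanishing_right (φ : Conv k H A) {ψ : Conv k H A} {n : ℕ}
    (hψ : ψ.ofConv ∈ vanishing k H A n) : (φ * ψ).ofConv ∈ vanishing k H A n := by
  simpa using mul_mem_vanishing (mem_vanishing_zero φ.ofConv) hψ

theorem pow_mem_vanishing {φ : Conv k H A} (h : φ.ofConv 1 = 0) (n : ℕ) :
    (φ ^ n).ofConv ∈ vanishing k H A n := by
  induction n with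
  | zero => exact mem_vanishing_zero _
  | succ n ih => rw [pow_succ]; exact mul_mem_vanishing ih (mem_vanishing_one h)

theorem isUnit_one_sub {φ : Conv k H A} (h : φ.ofConv 1 = 0) : IsUnit (1 - φ) := by
  obtain ⟨g, hg⟩ := exists_limit_of_stable (fun n => (∑ i ∈ Finset.range n, φ ^ i).ofConv)
    fun n w hw => by
      rw [Finset.sum_range_succ, ofConv_add, LinearMap.add_apply, pow_mem_vanishing h n w hw,
        add_zero]
  have tail (n : ℕ) : (toConv g - ∑ i ∈ Finset.range n, φ ^ i).ofConv ∈ vanishing k H A n :=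
    fun w hw => by rw [ofConv_sub, LinearMap.sub_apply, hg n w hw, sub_self]
  refine isUnit_iff_exists.mpr ⟨toConv g, ?_, ?_⟩ <;>
    refine eq_of_forall_sub_mem_vanishing fun n => ?_
  · have : (1 - φ) * toConv g - 1 =
        (1 - φ) * (toConv g - ∑ i ∈ Finset.range n, φ ^ i) - φ ^ n := by
      rw [mul_sub, mul_neg_geom_sum]; abel
    rw [this]
    exact sub_mem (mul_mem_vanishing_right _ (tail n)) (pow_mem_vanishing h n)
  · have : toConv g * (1 - φ) - 1 =
        (toConv g - ∑ i ∈ Finset.range n, φ ^ i) * (1 - φ) - φ ^ n := by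
      rw [sub_mul, geom_sum_mul_neg]; abel
    rw [this]
    exact sub_mem (mul_mem_vanishing_left (tail n) _) (pow_mem_vanishing h n)

theorem inverse_sub_geom_sum_mem_vanishing {φ : Conv k H A} (h : φ.ofConv 1 = 0) (n : ℕ) :
    (Ring.inverse (1 - φ) - ∑ i ∈ Finset.range n, φ ^ i).ofConv ∈ vanishing k H A n := by
  have : Ring.inverse (1 - φ) - ∑ i ∈ Finset.range n, φ ^ i = Ring.inverse (1 - φ) * φ ^ n := by
    rw [← Ring.inverse_mul_cancel_left (1 - φ) (∑ i ∈ Finset.range n, φ ^ i) (isUnit_one_sub h),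
      mul_neg_geom_sum, mul_sub, mul_one, sub_sub_cancel]
  rw [this]
  exact mul_mem_vanishing_right _ (pow_mem_vanishing h n)

/-- The linear maps of tensor coalgebras that do not increase the length of words. -/
def PreservesLength (φ : Bar k H →ₗ[k] Bar k H') : Prop :=
  ∀ n, ∀ w ∈ lengthLT k H n, φ w ∈ lengthLT k H' n

theorem PreservesLength.comp_mem_vanishing {φ : Bar k H →ₗ[k] Bar k H'}
    (hφ : PreservesLength φ) {f : Bar k H' →ₗ[k] M} {n : ℕ} (hf : f ∈ vanishing k H' M n) :
    f ∘ₗ φ ∈ vanishing k H M n :=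
  fun w hw => hf _ (hφ n w hw)

theorem PreservesLength.of_word {φ : Bar k H →ₗ[k] Bar k H'}
    (h : ∀ l : List H, φ (l.map (TensorAlgebra.ι k)).prod ∈ lengthLT k H' (l.length + 1)) :
    PreservesLength φ := fun n w hw => by
  suffices lengthLT k H n ≤ (lengthLT k H' n).comap φ from this hw
  exact lengthLT_le.mpr fun l hl => lengthLT_mono hl (h l)

theorem preservesLength_mul {φ ψ : Conv k H (Bar k H')} (hφ : PreservesLength φ.ofConv)
    (hψ : PreservesLength ψ.ofConv) : PreservesLength (φ * ψ).ofConv :=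
  .of_word fun l => by
    rw [convMul_word]
    refine sum_mem fun j hj => ?_
    have h := mul_mem_lengthLT (hφ _ _ (word_mem_lengthLT (l.take j).length.lt_succ_self))
      (hψ _ _ (word_mem_lengthLT (l.drop j).length.lt_succ_self))
    refine lengthLT_mono ?_ h
    simp only [List.length_take, List.length_drop, Finset.mem_range] at hj ⊢
    omega

theorem preservesLength_letters {a : Bar k H →ₗ[k] H'} (ha : a 1 = 0) :
    PreservesLength (letters a).ofConv :=
  .of_word fun l => by
    match l with
    | [] => simp [letters, ha]
    | _ :: l => exact lengthLT_mono (by simp) (ι_mem_lengthLT _)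

end Length

section Degree

variable {k : Type*} [Field k] {V : Type*} [AddCommGroup V] [Module k V]
  {W : Type*} [AddCommGroup W] [Module k W] {U : Type*} [AddCommGroup U] [Module k U]
  {𝒱 : ℤ → Submodule k V} {𝒲 : ℤ → Submodule k W} {𝒰 : ℤ → Submodule k U}

/-- The linear map `φ` of graded vector spaces is homogeneous of degree `c`. -/
def HasDegree (𝒱 : ℤ → Submodule k V) (𝒲 : ℤ → Submodule k W) (c : ℤ) (φ : V →ₗ[k] W) : Prop :=
  ∀ i, ∀ v ∈ 𝒱 i, φ v ∈ 𝒲 (i + c)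

namespace HasDegree

variable {b c d : ℤ} {φ ψ : V →ₗ[k] W} {χ : W →ₗ[k] U}

theorem zero_iff : HasDegree 𝒱 𝒲 0 φ ↔ ∀ i, ∀ v ∈ 𝒱 i, φ v ∈ 𝒲 i := by simp [HasDegree]

theorem id : HasDegree 𝒱 𝒱 0 LinearMap.id := zero_iff.mpr fun _ _ hv => hv

theorem add (hφ : HasDegree 𝒱 𝒲 c φ) (hψ : HasDegree 𝒱 𝒲 c ψ) : HasDegree 𝒱 𝒲 c (φ + ψ) :=
  fun i v hv => add_mem (hφ i v hv) (hψ i v hv)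

theorem sub (hφ : HasDegree 𝒱 𝒲 c φ) (hψ : HasDegree 𝒱 𝒲 c ψ) : HasDegree 𝒱 𝒲 c (φ - ψ) :=
  fun i v hv => sub_mem (hφ i v hv) (hψ i v hv)

theorem sum {ι : Type*} {s : Finset ι} {f : ι → V →ₗ[k] W}
    (h : ∀ i ∈ s, HasDegree 𝒱 𝒲 c (f i)) : HasDegree 𝒱 𝒲 c (∑ i ∈ s, f i) := fun d v hv => by
  rw [LinearMap.sum_apply]
  exact sum_mem fun i hi => h i hi d v hv

theorem comp (hχ : HasDegree 𝒲 𝒰 b χ) (hφ : HasDegree 𝒱 𝒲 c φ) (h : c + b = d) :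
    HasDegree 𝒱 𝒰 d (χ ∘ₗ φ) :=
  fun i v hv => h ▸ add_assoc i c b ▸ hχ _ _ (hφ i v hv)

end HasDegree

end Degree

section BarDegree

variable {k : Type*} [Field k] {H : Type*} [AddCommGroup H] [Module k H]
  {H' : Type*} [AddCommGroup H'] [Module k H']
  {ℋ : ℤ → Submodule k H} {ℋ' : ℤ → Submodule k H'}

theorem word_mem_barDegree (l : List (Σ i, ℋ i)) :
    (l.map fun o => TensorAlgebra.ι k (o.2 : H)).prod ∈ barDegree ℋ (l.map Sigma.fst).sum :=
  Submodule.subset_span ⟨l, rfl, rfl⟩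

theorem barDegree_le {d : ℤ} {P : Submodule k (Bar k H)} :
    barDegree ℋ d ≤ P ↔ ∀ l : List (Σ i, ℋ i), (l.map Sigma.fst).sum = d →
      (l.map fun o => TensorAlgebra.ι k (o.2 : H)).prod ∈ P :=
  Submodule.span_le.trans ⟨fun h l hl => h ⟨l, hl, rfl⟩, fun h _ ⟨l, hl, hw⟩ => hw ▸ h l hl⟩

theorem HasDegree.of_word {V : Type*} [AddCommGroup V] [Module k V] {𝒱 : ℤ → Submodule k V}
    {c : ℤ} {φ : Bar k H →ₗ[k] V}
    (h : ∀ l : List (Σ i, ℋ i), φ (l.map fun o => TensorAlgebra.ι k (o.2 : H)).prod ∈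
      𝒱 ((l.map Sigma.fst).sum + c)) : HasDegree (barDegree ℋ) 𝒱 c φ := fun d w hw => by
  suffices barDegree ℋ d ≤ (𝒱 (d + c)).comap φ from this hw
  exact barDegree_le.mpr fun l hl => hl ▸ h l

theorem HasDegree.of_approx {V : Type*} [AddCommGroup V] [Module k V] {𝒱 : ℤ → Submodule k V}
    {c : ℤ} {φ : Bar k H →ₗ[k] V}
    (h : ∀ n, ∃ ψ, HasDegree (barDegree ℋ) 𝒱 c ψ ∧ φ - ψ ∈ vanishing k H V n) :
    HasDegree (barDegree ℋ) 𝒱 c φ := .of_word fun l => by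
  obtain ⟨ψ, hψ, hφψ⟩ := h (l.length + 1)
  have hl := mem_vanishing_iff_word.mp hφψ (l.map fun o => (o.2 : H)) (by simp)
  rw [LinearMap.sub_apply, sub_eq_zero, List.map_map] at hl
  exact Eq.mpr (congrArg (· ∈ _) hl) (hψ _ _ (word_mem_barDegree l))

theorem mul_mem_barDegree {c d : ℤ} {v w : Bar k H} (hv : v ∈ barDegree ℋ c)
    (hw : w ∈ barDegree ℋ d) : v * w ∈ barDegree ℋ (c + d) := by
  suffices barDegree ℋ c ≤ (barDegree ℋ (c + d)).comap (LinearMap.mulRight k w) from this hv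
  refine barDegree_le.mpr fun l hl => ?_
  suffices barDegree ℋ d ≤ (barDegree ℋ (c + d)).comap (LinearMap.mulLeft k
    (l.map fun o => TensorAlgebra.ι k (o.2 : H)).prod) from this hw
  refine barDegree_le.mpr fun l' hl' => ?_
  simpa [hl, hl'] using word_mem_barDegree (l ++ l')

theorem hasDegree_ι : HasDegree ℋ (barDegree ℋ) 0 (TensorAlgebra.ι k) :=
  HasDegree.zero_iff.mpr fun i x hx => by simpa using word_mem_barDegree [⟨i, x, hx⟩]

theorem hasDegree_proj : HasDegree (barDegree ℋ) ℋ 0 (proj k H) :=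
  .of_word fun l => by
    match l with
    | [] => simp [proj_one]
    | [o] => simp [proj_ι]
    | o :: p :: l => simp [proj_ι_mul, counit_ι_mul]

theorem hasDegree_letters {a : Bar k H →ₗ[k] H'} {c : ℤ} (ha : HasDegree (barDegree ℋ) ℋ' c a) :
    HasDegree (barDegree ℋ) (barDegree ℋ') c (letters a).ofConv :=
  hasDegree_ι.comp ha (add_zero c)

theorem hasDegree_mul {φ ψ : Conv k H (Bar k H')} {b c d : ℤ}
    (hφ : HasDegree (barDegree ℋ) (barDegree ℋ') b φ.ofConv)
    (hψ : HasDegree (barDegree ℋ) (barDegree ℋ') c ψ.ofConv) (hd : b + c = d) :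
    HasDegree (barDegree ℋ) (barDegree ℋ') d (φ * ψ).ofConv :=
  .of_word fun l => by
    subst hd
    have h := convMul_word φ ψ (l.map fun o => (o.2 : H))
    simp only [← List.map_take, ← List.map_drop, List.map_map, Function.comp_def] at h
    rw [h]
    refine sum_mem fun j _ => ?_
    have hj := mul_mem_barDegree (hφ _ _ (word_mem_barDegree (l.take j)))
      (hψ _ _ (word_mem_barDegree (l.drop j)))
    rwa [add_add_add_comm, ← List.sum_append, ← List.map_append, List.take_append_drop] at hj

theorem hasDegree_one :
    HasDegree (barDegree ℋ) (barDegree ℋ') 0 (1 : Conv k H (Bar k H')).ofConv :=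
  .of_word fun l => by
    match l with
    | [] => simpa [coalgebra_counit_eq, counit_one] using word_mem_barDegree (ℋ := ℋ') []
    | o :: l => simp [coalgebra_counit_eq, counit_ι_mul]

end BarDegree

section Sign

variable {k : Type*} [Field k] {H : Type*} [AddCommGroup H] [Module k H]
  {H' : Type*} [AddCommGroup H'] [Module k H']
  (ℋ : ℤ → Submodule k H) [DirectSum.Decomposition ℋ]
  {ℋ' : ℤ → Submodule k H'} [DirectSum.Decomposition ℋ']

theorem mem_iSup_barDegree (w : Bar k H) : w ∈ ⨆ d, barDegree ℋ d := by
  induction w using bar_induction with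
  | one => exact Submodule.mem_iSup_of_mem 0 (by simpa using word_mem_barDegree (ℋ := ℋ) [])
  | add a b ha hb => exact add_mem ha hb
  | smul c a ha => exact Submodule.smul_mem _ _ ha
  | mul x w hw =>
    induction x using DirectSum.Decomposition.inductionOn ℋ with
    | zero => simp
    | add x y hx hy => rw [map_add, add_mul]; exact add_mem hx hy
    | homogeneous x =>
      induction hw using Submodule.iSup_induction' with
      | mem d w hw =>
        exact Submodule.mem_iSup_of_mem _ (mul_mem_barDegree (hasDegree_ι _ _ x.2) hw)
      | zero => simp
      | add a b _ _ ha hb => rw [mul_add]; exact add_mem ha hb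

theorem hom_ext_barDegree {M : Type*} [AddCommGroup M] [Module k M] {φ ψ : Bar k H →ₗ[k] M}
    (h : ∀ d, ∀ w ∈ barDegree ℋ d, φ w = ψ w) : φ = ψ :=
  LinearMap.ext fun w => by
    suffices ⨆ d, barDegree ℋ d ≤ LinearMap.eqLocus φ ψ from
      this (mem_iSup_barDegree ℋ w)
    exact iSup_le fun d w hw => h d w hw

theorem barSign_one : barSign ℋ (1 : Bar k H) = 1 := by simp [barSign]

theorem barSign_ι_mul (x : H) (w : Bar k H) :
    barSign ℋ (TensorAlgebra.ι k x * w) =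
      TensorAlgebra.ι k (letterSign ℋ x) * barSign ℋ w := by
  simp [barSign]

theorem barSign_comp_barSign : barSign ℋ ∘ₗ barSign ℋ = LinearMap.id :=
  hom_ext_barDegree ℋ fun d w hw => by
    rw [LinearMap.comp_apply, barSign_apply ℋ hw, map_smul, barSign_apply ℋ hw, smul_smul,
      ← Int.cast_mul, ← Units.val_mul, Int.units_mul_self]
    simp

variable {ℋ}

theorem HasDegree.barSign_comp {φ : Bar k H →ₗ[k] Bar k H'} {c : ℤ}
    (hφ : HasDegree (barDegree ℋ) (barDegree ℋ') c φ) :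
    barSign ℋ' ∘ₗ φ = ((c.negOnePow : ℤ) : k) • (φ ∘ₗ barSign ℋ) :=
  hom_ext_barDegree ℋ fun d w hw => by
    rw [LinearMap.comp_apply, barSign_apply _ (hφ d w hw), LinearMap.smul_apply,
      LinearMap.comp_apply, barSign_apply _ hw, map_smul, smul_smul, Int.negOnePow_add, mul_comm]
    simp

end Sign

section CoalgebraMaps

variable {k : Type*} [Field k] {H : Type*} [AddCommGroup H] [Module k H]
  {H' : Type*} [AddCommGroup H'] [Module k H'] {H'' : Type*} [AddCommGroup H''] [Module k H'']

/-- A homomorphism of counital tensor coalgebras that preserves the empty word. -/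
structure IsCoalgebraMap (V : Bar k H →ₗ[k] Bar k H') : Prop where
  map_one : V 1 = 1
  comul_comp : deconc k H' ∘ₗ V = TensorProduct.map V V ∘ₗ deconc k H
  counit_comp : counit k H' ∘ₗ V = counit k H

theorem isCoalgebraMap_id : IsCoalgebraMap (LinearMap.id : Bar k H →ₗ[k] Bar k H) where
  map_one := rfl
  comul_comp := by simp
  counit_comp := by simp

theorem IsCoalgebraMap.comp {V : Bar k H' →ₗ[k] Bar k H''} {U : Bar k H →ₗ[k] Bar k H'}
    (hV : IsCoalgebraMap V) (hU : IsCoalgebraMap U) : IsCoalgebraMap (V ∘ₗ U) where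
  map_one := by rw [LinearMap.comp_apply, hU.map_one, hV.map_one]
  comul_comp := by
    rw [← LinearMap.comp_assoc, hV.comul_comp, LinearMap.comp_assoc, hU.comul_comp,
      ← LinearMap.comp_assoc, TensorProduct.map_comp]
  counit_comp := by rw [← LinearMap.comp_assoc, hV.counit_comp, hU.counit_comp]

theorem isCoalgebraMap_barSign (ℋ : ℤ → Submodule k H) [DirectSum.Decomposition ℋ] :
    IsCoalgebraMap (barSign ℋ) where
  map_one := barSign_one ℋ
  comul_comp := bar_hom_ext (by simp [deconc_one, barSign_one]) fun x w hw => by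
    simp only [LinearMap.comp_apply] at hw ⊢
    rw [barSign_ι_mul, deconc_ι_mul', hw, deconc_ι_mul', map_add, TensorProduct.map_tmul,
      barSign_ι_mul, barSign_one]
    congr 1
    induction deconc k H w using TensorProduct.induction_on with
    | zero => simp
    | tmul u v => simp [barSign_ι_mul]
    | add s t hs ht => simp only [mul_add, map_add, hs, ht]
  counit_comp := bar_hom_ext (by simp [barSign_one]) fun x w _ => by
    simp [barSign_ι_mul, counit_ι_mul]

theorem AInftyMorphism.isCoalgebraMap {ℋ : ℤ → Submodule k H} [DirectSum.Decomposition ℋ]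
    {ℋ' : ℤ → Submodule k H'} [DirectSum.Decomposition ℋ'] {A : AInftyAlgebra ℋ}
    {A' : AInftyAlgebra ℋ'} (F : AInftyMorphism A A') : IsCoalgebraMap F.F where
  map_one := F.F_one
  comul_comp := F.comul_comp
  counit_comp := F.counit_comp

theorem counit_letters_mul (a : Bar k H →ₗ[k] H') (φ : Conv k H (Bar k H')) :
    counit k H' ∘ₗ (letters a * φ).ofConv = 0 := by
  have h :
      counit k H' ∘ₗ LinearMap.mul' k _ ∘ₗ TensorProduct.map (letters a).ofConv φ.ofConv = 0 := by
    ext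
    simp [letters, counit_ι_mul]
  rw [convMul_eq, ofConv_toConv, ← LinearMap.comp_assoc, ← LinearMap.comp_assoc,
    LinearMap.comp_assoc _ _ (counit k H'), h, LinearMap.zero_comp]

theorem one_sub_inl_letters_mul_deconc {a : Bar k H →ₗ[k] H'} {φ ψ : Conv k H (Bar k H')}
    (h : (1 - letters a) * φ = ψ) :
    (1 - inl (letters a)) * toConv (deconc k H' ∘ₗ φ.ofConv) + inr ψ =
      toConv (deconc k H' ∘ₗ ψ.ofConv) + inr φ := by
  have hφ : φ = ψ + letters a * φ := by rw [← h, sub_mul, one_mul, sub_add_cancel]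
  have hΔ : toConv (deconc k H' ∘ₗ φ.ofConv) = toConv (deconc k H' ∘ₗ ψ.ofConv) +
      (inr (letters a * φ) + inl (letters a) * toConv (deconc k H' ∘ₗ φ.ofConv)) := by
    rw [← deconc_letters_mul, ← toConv_add, ← LinearMap.comp_add, ← ofConv_add, ← hφ]
  have hinr : inr (A := Bar k H') φ = inr ψ + inr (letters a * φ) := by rw [← map_add, ← hφ]
  rw [sub_mul, one_mul, hinr]
  nth_rw 1 [hΔ]
  abel

theorem deconc_comp_one :
    toConv (deconc k H' ∘ₗ (1 : Conv k H (Bar k H')).ofConv) = inr 1 := by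
  ext w
  simp [deconc_one, Algebra.algebraMap_eq_smul_one, Algebra.TensorProduct.one_def]

/-- The coalgebra map with letter component `a`, that is the geometric series
`∑ n, (letters a)ⁿ` in the convolution ring; `a 1 = 0` is needed for it to converge. -/
def ofLetters (a : Bar k H →ₗ[k] H') : Bar k H →ₗ[k] Bar k H' :=
  (Ring.inverse (1 - letters a)).ofConv

section

variable {a : Bar k H →ₗ[k] H'} (ha : a 1 = 0)
include ha

theorem isUnit_one_sub_letters : IsUnit (1 - letters a) :=
  isUnit_one_sub (by simp [letters, ha])

theorem toConv_ofLetters_eq : toConv (ofLetters a) = 1 + letters a * toConv (ofLetters a) := by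
  have h := Ring.mul_inverse_cancel _ (isUnit_one_sub_letters ha)
  rw [sub_mul, one_mul, sub_eq_iff_eq_add] at h
  exact h

theorem hasDegree_ofLetters {ℋ : ℤ → Submodule k H} {ℋ' : ℤ → Submodule k H'}
    (hd : HasDegree (barDegree ℋ) ℋ' 0 a) :
    HasDegree (barDegree ℋ) (barDegree ℋ') 0 (ofLetters a) := by
  have hpow (n : ℕ) : HasDegree (barDegree ℋ) (barDegree ℋ') 0 (letters a ^ n).ofConv := by
    induction n with
    | zero => rw [pow_zero]; exact hasDegree_one
    | succ n ih => rw [pow_succ]; exact hasDegree_mul ih (hasDegree_letters hd) (add_zero 0)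
  have hsum (n : ℕ) : HasDegree (barDegree ℋ) (barDegree ℋ') 0
      (∑ i ∈ Finset.range n, letters a ^ i).ofConv := by
    rw [ofConv_sum]
    exact .sum fun i _ => hpow i
  exact .of_approx fun n => ⟨_, hsum n,
    inverse_sub_geom_sum_mem_vanishing (by simp [letters, ha]) n⟩

theorem isCoalgebraMap_ofLetters : IsCoalgebraMap (ofLetters a) where
  map_one := by
    have h := congrArg (fun φ => φ.ofConv 1) (toConv_ofLetters_eq ha)
    simp only [ofConv_add, LinearMap.add_apply, convMul_one] at h
    simpa [letters, ha, coalgebra_counit_eq, counit_one] using h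
  comul_comp := by
    set G := ofLetters a
    have hG : (1 - letters a) * toConv G = 1 :=
      Ring.mul_inverse_cancel _ (isUnit_one_sub_letters ha)
    have hunit : IsUnit (1 - inl (B := Bar k H') (letters a)) := by
      simpa using (isUnit_one_sub_letters ha).map (Conv.map Algebra.TensorProduct.includeLeft)
    have hleft : (1 - inl (letters a)) * toConv (deconc k H' ∘ₗ G) = inr (toConv G) := by
      have h := one_sub_inl_letters_mul_deconc hG
      rw [deconc_comp_one, add_comm] at h
      exact add_left_cancel h
    have hright : (1 - inl (letters a)) * (inl (toConv G) * inr (toConv G)) = inr (toConv G) := by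
      rw [← mul_assoc, ← map_one (Conv.map Algebra.TensorProduct.includeLeft), ← map_sub,
        ← map_mul, hG, map_one, one_mul]
    exact congrArg ofConv (hunit.mul_left_cancel (hleft.trans (map_deconc G G ▸ hright.symm)))
  counit_comp := by
    have h := congrArg (fun φ => counit k H' ∘ₗ φ.ofConv) (toConv_ofLetters_eq ha)
    simp only [ofConv_add, LinearMap.comp_add, counit_letters_mul, add_zero] at h
    rw [h]
    ext w
    simp [coalgebra_counit_eq, counit]

end

end CoalgebraMaps

section Coderivations

variable {k : Type*} [Field k] {H : Type*} [AddCommGroup H] [Module k H]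
  {H' : Type*} [AddCommGroup H'] [Module k H'] {U V D : Bar k H →ₗ[k] Bar k H'}

theorem firstLetter_comp_deconc (X : Bar k H →ₗ[k] Bar k H') (hX : counit k H' ∘ₗ X = 0) :
    firstLetter ∘ₗ deconc k H' ∘ₗ X = X :=
  LinearMap.ext fun w => by
    have hw : counit k H' (X w) = 0 := LinearMap.congr_fun hX w
    rw [LinearMap.comp_apply, LinearMap.comp_apply, firstLetter_deconc, hw, map_zero, sub_zero]

namespace IsCoalgebraMap

variable (hV : IsCoalgebraMap V)
include hV

theorem one_sub_letters_mul : (1 - letters (proj k H' ∘ₗ V)) * toConv V = 1 := by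
  rw [sub_mul, one_mul, ← firstLetter_inl_mul_inr, ← map_deconc, ← hV.comul_comp, sub_eq_iff_eq_add]
  ext w
  have hw : counit k H' (V w) = counit k H w := LinearMap.congr_fun hV.counit_comp w
  change _ = _ + firstLetter (deconc k H' (V w))
  rw [firstLetter_deconc, hw]
  simp [coalgebra_counit_eq]

theorem isUnit_one_sub_letters : IsUnit (1 - letters (proj k H' ∘ₗ V)) :=
  AInfty.isUnit_one_sub_letters (by rw [LinearMap.comp_apply, hV.map_one, proj_one])

theorem eq_mul_firstLetter {X : Bar k H →ₗ[k] Bar k H'} (hX : counit k H' ∘ₗ X = 0)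
    {R : Conv k H (Bar k H' ⊗[k] Bar k H')}
    (h : toConv (deconc k H' ∘ₗ X) = R + inl (toConv V) * inr (toConv X)) :
    toConv X = toConv V * toConv (firstLetter ∘ₗ R.ofConv) := by
  refine hV.isUnit_one_sub_letters.mul_left_cancel ?_
  rw [← mul_assoc, hV.one_sub_letters_mul, one_mul, sub_mul, one_mul, ← firstLetter_inl_mul_inr,
    sub_eq_iff_eq_add, ← toConv_add, ← LinearMap.comp_add, ← ofConv_add, ← h]
  exact congrArg toConv (firstLetter_comp_deconc X hX).symm

end IsCoalgebraMap

/-- `D` is a coderivation along `U` and `V`, that is `Δ D = (D ⊗ U + V ⊗ D) Δ`. -/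
def IsCoderivation (U V D : Bar k H →ₗ[k] Bar k H') : Prop :=
  deconc k H' ∘ₗ D =
    TensorProduct.map D U ∘ₗ deconc k H + TensorProduct.map V D ∘ₗ deconc k H

theorem isCoderivation_iff : IsCoderivation U V D ↔ toConv (deconc k H' ∘ₗ D) =
    inl (toConv D) * inr (toConv U) + inl (toConv V) * inr (toConv D) := by
  rw [IsCoderivation, ← map_deconc, ← map_deconc, ← toConv_add, (toConv_injective).eq_iff]

theorem counit_mul_counit (w : Bar k H) :
    LinearMap.mul' k k (TensorProduct.map (counit k H) (counit k H) (deconc k H w)) =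
      counit k H w := by
  conv_rhs => rw [← counit_deconc w]
  induction deconc k H w using TensorProduct.induction_on with
  | zero => simp
  | tmul u v => simp
  | add s t hs ht => simp only [map_add, hs, ht]

theorem IsCoderivation.counit_comp (hU : IsCoalgebraMap U) (hV : IsCoalgebraMap V)
    (hD : IsCoderivation U V D) : counit k H' ∘ₗ D = 0 := by
  have hmul : counit k H' ∘ₗ D = LinearMap.mul' k k ∘ₗ
      TensorProduct.map (counit k H') (counit k H') ∘ₗ deconc k H' ∘ₗ D :=
    LinearMap.ext fun w => (counit_mul_counit (D w)).symm
  have hsplit (φ ψ : Bar k H →ₗ[k] Bar k H') : LinearMap.mul' k k ∘ₗ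
      TensorProduct.map (counit k H') (counit k H') ∘ₗ TensorProduct.map φ ψ ∘ₗ deconc k H =
        (toConv (counit k H' ∘ₗ φ) * toConv (counit k H' ∘ₗ ψ)).ofConv := by
    rw [← LinearMap.comp_assoc (deconc k H), ← TensorProduct.map_comp, convMul_eq]
  have hone : toConv (counit k H) = (1 : Conv k H k) := by
    ext w
    simp [coalgebra_counit_eq]
  have hdouble : counit k H' ∘ₗ D = counit k H' ∘ₗ D + counit k H' ∘ₗ D := by
    conv_lhs => rw [hmul, hD, LinearMap.comp_add, LinearMap.comp_add, hsplit, hsplit,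
      hU.counit_comp, hV.counit_comp, hone, mul_one, one_mul]
  exact left_eq_add.mp hdouble

section

variable (hU : IsCoalgebraMap U) (hV : IsCoalgebraMap V)
include hU hV

theorem IsCoderivation.eq_mul_letters_mul (hD : IsCoderivation U V D) :
    toConv D = toConv V * (letters (proj k H' ∘ₗ D) * toConv U) := by
  rw [hV.eq_mul_firstLetter (hD.counit_comp hU hV) (isCoderivation_iff.mp hD),
    firstLetter_inl_mul_inr]

theorem isCoderivation_mul_letters_mul (t : Bar k H →ₗ[k] H') :
    IsCoderivation U V (toConv V * (letters t * toConv U)).ofConv := by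
  set a := proj k H' ∘ₗ V
  set T := toConv V * (letters t * toConv U) with hT
  have hV₁ : (1 - letters a) * toConv V = 1 := hV.one_sub_letters_mul
  have hT₁ : (1 - letters a) * T = letters t * toConv U := by
    rw [hT, ← mul_assoc, hV₁, one_mul]
  have hinl : inl (B := Bar k H') (1 - letters a) = 1 - inl (letters a) :=
    (map_sub (Conv.map _) 1 _).trans (by rw [map_one])
  have hunit : IsUnit (1 - inl (B := Bar k H') (letters a)) :=
    hinl ▸ hV.isUnit_one_sub_letters.map (Conv.map Algebra.TensorProduct.includeLeft)
  refine isCoderivation_iff.mpr (hunit.mul_left_cancel ?_)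
  have hΔ := one_sub_inl_letters_mul_deconc hT₁
  rw [deconc_letters_mul, ofConv_toConv, hU.comul_comp, map_deconc,
    ← mul_assoc (inl (letters t)), ← map_mul] at hΔ
  rw [← hinl, mul_add, ← mul_assoc, ← mul_assoc, ← map_mul, ← map_mul, hV₁, map_one, one_mul,
    toConv_ofConv, hT₁, hinl]
  exact add_right_cancel (hΔ.trans (by abel))

end

end Coderivations

section Contraction

variable {k : Type*} [Field k] {V : Type*} [AddCommGroup V] [Module k V]
  {W : Type*} [AddCommGroup W] [Module k W]

theorem exists_contraction (d : V →ₗ[k] V) (hd : ∀ v, d (d v) = 0)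
    (hex : ∀ v, d v = 0 → ∃ u, d u = v) : ∃ s : V →ₗ[k] V, ∀ v, d (s v) + s (d v) = v := by
  obtain ⟨σ, hσ⟩ := d.rangeRestrict.exists_rightInverse_of_surjective d.range_rangeRestrict
  obtain ⟨r, hr⟩ := σ.exists_extend
  have hdrd (v : V) : d (r (d v)) = d v := by
    have h : r (d v) = σ ⟨d v, v, rfl⟩ := LinearMap.congr_fun hr ⟨d v, v, rfl⟩
    rw [h]
    exact congrArg Subtype.val (LinearMap.congr_fun hσ ⟨d v, v, rfl⟩)
  refine ⟨r - r ∘ₗ r ∘ₗ d, fun v => ?_⟩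
  obtain ⟨u, hu⟩ := hex (v - r (d v)) (by rw [map_sub, hdrd, sub_self])
  have hdr : d (r v) - d (r (r (d v))) = v - r (d v) := by rw [← map_sub, ← map_sub, ← hu, hdrd]
  simp only [LinearMap.sub_apply, LinearMap.comp_apply, hd, map_zero, sub_zero, map_sub]
  rw [hdr, sub_add_cancel]

variable (𝒱 : ℤ → Submodule k V) [DirectSum.Decomposition 𝒱]
  (𝒲 : ℤ → Submodule k W) [DirectSum.Decomposition 𝒲]

/-- The projection of a graded vector space to its degree `i` part. -/
def degreeProj (i : ℤ) : V →ₗ[k] V :=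
  (𝒱 i).subtype ∘ₗ DirectSum.component k ℤ (fun i => 𝒱 i) i ∘ₗ
    (DirectSum.decomposeLinearEquiv 𝒱).toLinearMap

theorem degreeProj_apply (i : ℤ) (v : V) : degreeProj 𝒱 i v = DirectSum.decompose 𝒱 v i := rfl

theorem degreeProj_of_mem {i : ℤ} {v : V} (hv : v ∈ 𝒱 i) : degreeProj 𝒱 i v = v :=
  DirectSum.decompose_of_mem_same 𝒱 hv

/-- The degree `c` part of a linear map of graded vector spaces. -/
def degreePart (c : ℤ) (φ : V →ₗ[k] W) : V →ₗ[k] W :=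
  DirectSum.toModule k ℤ W (fun i => degreeProj 𝒲 (i + c) ∘ₗ φ ∘ₗ (𝒱 i).subtype) ∘ₗ
    (DirectSum.decomposeLinearEquiv 𝒱).toLinearMap

variable {𝒱}

theorem degreePart_apply (c : ℤ) (φ : V →ₗ[k] W) {i : ℤ} {v : V} (hv : v ∈ 𝒱 i) :
    degreePart 𝒱 𝒲 c φ v = degreeProj 𝒲 (i + c) (φ v) := by
  simp [degreePart, DirectSum.decomposeLinearEquiv_apply, DirectSum.decompose_of_mem 𝒱 hv,
    ← DirectSum.lof_eq_of k]

theorem hasDegree_degreePart (c : ℤ) (φ : V →ₗ[k] W) : HasDegree 𝒱 𝒲 c (degreePart 𝒱 𝒲 c φ) :=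
  fun _ v hv => by
    rw [degreePart_apply 𝒲 c φ hv]
    exact SetLike.coe_mem (DirectSum.decompose 𝒲 (φ v) _)

variable {𝒲}

theorem HasDegree.map_degreeProj {φ : V →ₗ[k] W} {c : ℤ} (hφ : HasDegree 𝒱 𝒲 c φ) (i : ℤ)
    (v : V) : φ (degreeProj 𝒱 i v) = degreeProj 𝒲 (i + c) (φ v) := by
  induction v using DirectSum.Decomposition.inductionOn 𝒱 with
  | zero => simp
  | add x y hx hy => simp only [map_add, hx, hy]
  | @homogeneous j x =>
    rcases eq_or_ne j i with rfl | h
    · rw [degreeProj_of_mem 𝒱 x.2, degreeProj_of_mem 𝒲 (hφ _ _ x.2)]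
    · rw [degreeProj_apply, degreeProj_apply, DirectSum.decompose_of_mem_ne 𝒱 x.2 h,
        DirectSum.decompose_of_mem_ne 𝒲 (hφ _ _ x.2) (by simpa using h), map_zero]

theorem exists_hasDegree_contraction {d : V →ₗ[k] V} (hdeg : HasDegree 𝒱 𝒱 1 d)
    (hd : ∀ v, d (d v) = 0) (hex : ∀ v, d v = 0 → ∃ u, d u = v) :
    ∃ s : V →ₗ[k] V, HasDegree 𝒱 𝒱 (-1) s ∧ ∀ v, d (s v) + s (d v) = v := by
  obtain ⟨s, hs⟩ := exists_contraction d hd hex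
  refine ⟨degreePart 𝒱 𝒱 (-1) s, hasDegree_degreePart 𝒱 _ _, LinearMap.congr_fun
    (f := d ∘ₗ degreePart 𝒱 𝒱 (-1) s + degreePart 𝒱 𝒱 (-1) s ∘ₗ d) (g := LinearMap.id) ?_⟩
  refine DirectSum.decompose_lhom_ext 𝒱 fun i => LinearMap.ext fun ⟨v, hv⟩ => ?_
  change d (degreePart 𝒱 𝒱 (-1) s v) + degreePart 𝒱 𝒱 (-1) s (d v) = v
  rw [degreePart_apply 𝒱 _ _ hv, degreePart_apply 𝒱 _ _ (hdeg i v hv), hdeg.map_degreeProj,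
    neg_add_cancel_right, add_neg_cancel_right, ← map_add, hs, degreeProj_of_mem 𝒱 hv]

end Contraction

section Cone

variable {k : Type*} [Field k] {V : Type*} [AddCommGroup V] [Module k V]
  {W : Type*} [AddCommGroup W] [Module k W]

/-- The grading of the mapping cone `V ⊕ W[-1]`. -/
def coneDegree (𝒱 : ℤ → Submodule k V) (𝒲 : ℤ → Submodule k W) (i : ℤ) : Submodule k (V × W) :=
  (𝒱 i).prod (𝒲 (i - 1))

/-- The differential of the mapping cone of `f : (V, d) → (W, d')`. -/
def coneDifferential (d : V →ₗ[k] V) (d' : W →ₗ[k] W) (f : V →ₗ[k] W) : V × W →ₗ[k] V × W :=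
  (d ∘ₗ LinearMap.fst k V W).prod (f ∘ₗ LinearMap.fst k V W - d' ∘ₗ LinearMap.snd k V W)

variable {𝒱 : ℤ → Submodule k V} {𝒲 : ℤ → Submodule k W} {d : V →ₗ[k] V} {d' : W →ₗ[k] W}
  {f : V →ₗ[k] W}

theorem coneDifferential_apply (x : V × W) :
    coneDifferential d d' f x = (d x.1, f x.1 - d' x.2) := rfl

theorem hasDegree_coneDifferential (hd : HasDegree 𝒱 𝒱 1 d) (hd' : HasDegree 𝒲 𝒲 1 d')
    (hf : HasDegree 𝒱 𝒲 0 f) :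
    HasDegree (coneDegree 𝒱 𝒲) (coneDegree 𝒱 𝒲) 1 (coneDifferential d d' f) := fun i x hx => by
  have hw := hd' _ _ hx.2
  rw [sub_add_cancel] at hw
  exact ⟨hd i _ hx.1, (add_sub_cancel_right i 1).symm ▸
    sub_mem (HasDegree.zero_iff.mp hf i _ hx.1) hw⟩

theorem coneDifferential_exact (hfd : ∀ v, f (d v) = d' (f v))
    (hinj : ∀ v w, d v = 0 → f v = d' w → ∃ u, d u = v)
    (hsurj : ∀ w, d' w = 0 → ∃ v w', d v = 0 ∧ w = f v + d' w') (x : V × W)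
    (hx : coneDifferential d d' f x = 0) : ∃ y, coneDifferential d d' f y = x := by
  obtain ⟨v, w⟩ := x
  obtain ⟨hv, hvw⟩ := Prod.mk_eq_zero.mp hx
  obtain ⟨u, rfl⟩ := hinj v w hv (sub_eq_zero.mp hvw)
  obtain ⟨z, w', hz, huw⟩ := hsurj (f u - w) (by rw [map_sub, ← hfd]; exact hvw)
  refine ⟨(u - z, w'), Prod.ext ?_ ?_⟩
  · rw [coneDifferential_apply, map_sub, hz, sub_zero]
  · change f (u - z) - d' w' = w
    rw [map_sub, sub_sub, ← huw, sub_sub_cancel]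

section Decomposition

variable (𝒱 𝒲)

/-- The inclusion `v ↦ (v, 0)` in degree `i`. -/
def coneInl (i : ℤ) : 𝒱 i →ₗ[k] coneDegree 𝒱 𝒲 i :=
  (LinearMap.inl k V W).restrict fun _ hv => ⟨hv, zero_mem _⟩

/-- The inclusion `w ↦ (0, w)` in degree `i`. -/
def coneInr (i : ℤ) : 𝒲 i →ₗ[k] coneDegree 𝒱 𝒲 (i + 1) :=
  (LinearMap.inr k V W).restrict fun _ hw => ⟨zero_mem _, (add_sub_cancel_right i 1).symm ▸ hw⟩

theorem coe_coneInl {i : ℤ} (v : 𝒱 i) : (coneInl 𝒱 𝒲 i v : V × W) = (↑v, 0) := rfl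

theorem coe_coneInr {i : ℤ} (w : 𝒲 i) : (coneInr 𝒱 𝒲 i w : V × W) = (0, ↑w) := rfl

variable [DirectSum.Decomposition 𝒱] [DirectSum.Decomposition 𝒲]

/-- The decomposition of the elements of the mapping cone into their homogeneous parts. -/
def coneDecompose : V × W →ₗ[k] DirectSum ℤ fun i => coneDegree 𝒱 𝒲 i :=
  LinearMap.coprod
    (DirectSum.toModule k ℤ _ (fun i => DirectSum.lof k ℤ _ i ∘ₗ coneInl 𝒱 𝒲 i) ∘ₗ
      (DirectSum.decomposeLinearEquiv 𝒱).toLinearMap)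
    (DirectSum.toModule k ℤ _ (fun i => DirectSum.lof k ℤ _ (i + 1) ∘ₗ coneInr 𝒱 𝒲 i) ∘ₗ
      (DirectSum.decomposeLinearEquiv 𝒲).toLinearMap)

theorem coneDecompose_apply {i : ℤ} {v : V} {w : W} (hv : v ∈ 𝒱 (i + 1)) (hw : w ∈ 𝒲 i) :
    coneDecompose 𝒱 𝒲 (v, w) = DirectSum.lof k ℤ (fun i => coneDegree 𝒱 𝒲 i) (i + 1)
      (coneInl 𝒱 𝒲 (i + 1) ⟨v, hv⟩ + coneInr 𝒱 𝒲 i ⟨w, hw⟩) := by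
  simp [coneDecompose, DirectSum.decomposeLinearEquiv_apply, DirectSum.decompose_of_mem 𝒱 hv,
    DirectSum.decompose_of_mem 𝒲 hw, ← DirectSum.lof_eq_of k]

/-- The mapping cone as a graded vector space. -/
instance : DirectSum.Decomposition (coneDegree 𝒱 𝒲) :=
  .ofLinearMap _ (coneDecompose 𝒱 𝒲)
    (by
      refine LinearMap.prod_ext (DirectSum.decompose_lhom_ext 𝒱 fun i => ?_)
        (DirectSum.decompose_lhom_ext 𝒲 fun i => ?_) <;> ext x <;>
      simp [coneDecompose, DirectSum.decomposeLinearEquiv_apply, ← DirectSum.lof_eq_of k,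
        coe_coneInl, coe_coneInr])
    (by
      refine DirectSum.linearMap_ext k fun i => LinearMap.ext fun ⟨⟨v, w⟩, hv, hw⟩ => ?_
      obtain ⟨j, rfl⟩ : ∃ j, i = j + 1 := ⟨i - 1, by ring⟩
      replace hw : w ∈ 𝒲 j := by simpa using hw
      simp only [LinearMap.comp_apply, DirectSum.coeLinearMap_lof, LinearMap.id_apply]
      rw [coneDecompose_apply 𝒱 𝒲 hv hw]
      congr 1
      ext <;> simp [coe_coneInl, coe_coneInr])

end Decomposition

theorem exists_cone_contraction [DirectSum.Decomposition 𝒱] [DirectSum.Decomposition 𝒲]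
    (hd : HasDegree 𝒱 𝒱 1 d) (hd' : HasDegree 𝒲 𝒲 1 d') (hf : HasDegree 𝒱 𝒲 0 f)
    (hdd : ∀ v, d (d v) = 0) (hdd' : ∀ w, d' (d' w) = 0) (hfd : ∀ v, f (d v) = d' (f v))
    (hinj : ∀ v w, d v = 0 → f v = d' w → ∃ u, d u = v)
    (hsurj : ∀ w, d' w = 0 → ∃ v w', d v = 0 ∧ w = f v + d' w') :
    ∃ s : V × W →ₗ[k] V × W, HasDegree (coneDegree 𝒱 𝒲) (coneDegree 𝒱 𝒲) (-1) s ∧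
      ∀ x, coneDifferential d d' f (s x) + s (coneDifferential d d' f x) = x :=
  exists_hasDegree_contraction (hasDegree_coneDifferential hd hd' hf)
    (fun x => by simp [coneDifferential_apply, hdd, hdd', hfd])
    (coneDifferential_exact hfd hinj hsurj)

end Cone

section TensorProduct

variable {k : Type*} [Field k] {U : Type*} [AddCommGroup U] [Module k U]
  {V : Type*} [AddCommGroup V] [Module k V] {M : Type*} [AddCommGroup M] [Module k M]
  {N : Type*} [AddCommGroup N] [Module k N]

theorem map_sub_left (f g : U →ₗ[k] M) (h : V →ₗ[k] N) :
    TensorProduct.map (f - g) h = TensorProduct.map f h - TensorProduct.map g h :=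
  TensorProduct.ext' fun u v => by simp [TensorProduct.sub_tmul]

theorem map_sub_right (f : U →ₗ[k] M) (g h : V →ₗ[k] N) :
    TensorProduct.map f (g - h) = TensorProduct.map f g - TensorProduct.map f h :=
  TensorProduct.ext' fun u v => by simp [TensorProduct.tmul_sub]

end TensorProduct

section CoderivationComposition

variable {k : Type*} [Field k] {H : Type*} [AddCommGroup H] [Module k H]
  {H' : Type*} [AddCommGroup H'] [Module k H'] {H'' : Type*} [AddCommGroup H''] [Module k H'']

theorem IsCoderivation.sub {U V D E : Bar k H →ₗ[k] Bar k H'} (hD : IsCoderivation U V D)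
    (hE : IsCoderivation U V E) : IsCoderivation U V (D - E) := by
  rw [IsCoderivation, LinearMap.comp_sub, hD, hE, map_sub_left, map_sub_right, LinearMap.sub_comp,
    LinearMap.sub_comp]
  abel

theorem IsCoderivation.comp {U V D : Bar k H' →ₗ[k] Bar k H''} (hD : IsCoderivation U V D)
    {W : Bar k H →ₗ[k] Bar k H'} (hW : IsCoalgebraMap W) :
    IsCoderivation (U ∘ₗ W) (V ∘ₗ W) (D ∘ₗ W) := by
  rw [IsCoderivation, ← LinearMap.comp_assoc, hD, LinearMap.add_comp, LinearMap.comp_assoc,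
    LinearMap.comp_assoc, hW.comul_comp, ← LinearMap.comp_assoc, ← LinearMap.comp_assoc,
    ← TensorProduct.map_comp, ← TensorProduct.map_comp]

theorem IsCoalgebraMap.comp_isCoderivation {W : Bar k H' →ₗ[k] Bar k H''} (hW : IsCoalgebraMap W)
    {U V D : Bar k H →ₗ[k] Bar k H'} (hD : IsCoderivation U V D) :
    IsCoderivation (W ∘ₗ U) (W ∘ₗ V) (W ∘ₗ D) := by
  rw [IsCoderivation, ← LinearMap.comp_assoc, hW.comul_comp, LinearMap.comp_assoc, hD,
    LinearMap.comp_add, ← LinearMap.comp_assoc, ← LinearMap.comp_assoc, ← TensorProduct.map_comp,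
    ← TensorProduct.map_comp]

end CoderivationComposition

section Differential

variable {k : Type*} [Field k] {H : Type*} [AddCommGroup H] [Module k H]
  {H' : Type*} [AddCommGroup H'] [Module k H']
  {ℋ : ℤ → Submodule k H} [DirectSum.Decomposition ℋ]
  {ℋ' : ℤ → Submodule k H'} [DirectSum.Decomposition ℋ']

theorem preservesLength_id : PreservesLength (LinearMap.id : Bar k H →ₗ[k] Bar k H) :=
  fun _ _ hw => hw

theorem preservesLength_barSign : PreservesLength (barSign ℋ) :=
  .of_word fun l => by
    induction l with
    | nil => simpa [barSign_one] using word_mem_lengthLT (k := k) (l := ([] : List H)) one_pos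
    | cons x l ih =>
      rw [List.map_cons, List.prod_cons, barSign_ι_mul, List.length_cons, add_assoc,
        add_comm l.length, add_assoc, add_comm 1 l.length]
      exact mul_mem_lengthLT (ι_mem_lengthLT _) ih

theorem HasDegree.barSign_comp_of_zero {φ : Bar k H →ₗ[k] Bar k H'}
    (hφ : HasDegree (barDegree ℋ) (barDegree ℋ') 0 φ) : barSign ℋ' ∘ₗ φ = φ ∘ₗ barSign ℋ := by
  simpa using hφ.barSign_comp

namespace AInftyAlgebra

variable (A : AInftyAlgebra ℋ)

theorem isCoderivation : IsCoderivation LinearMap.id (barSign ℋ) A.m := A.coderivation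

theorem hasDegree_m : HasDegree (barDegree ℋ) (barDegree ℋ) 1 A.m := A.degree_one

theorem hasDegree_m₁ : HasDegree ℋ ℋ 1 A.m₁ := fun i x hx => by
  have h := hasDegree_proj _ _ (A.degree_one _ _ (hasDegree_ι i x hx))
  rwa [A.m_ι, proj_ι, add_zero, add_zero] at h

theorem barSign_comp_m : barSign ℋ ∘ₗ A.m = -(A.m ∘ₗ barSign ℋ) := by
  rw [A.hasDegree_m.barSign_comp]
  ext
  simp

theorem preservesLength_m : PreservesLength A.m := by
  have h := A.isCoderivation.eq_mul_letters_mul isCoalgebraMap_id (isCoalgebraMap_barSign ℋ)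
  rw [← ofConv_toConv A.m, h]
  exact preservesLength_mul preservesLength_barSign (preservesLength_mul
    (preservesLength_letters (by rw [LinearMap.comp_apply, A.m_one, map_zero])) preservesLength_id)

end AInftyAlgebra

namespace AInftyMorphism

variable {A : AInftyAlgebra ℋ} {A' : AInftyAlgebra ℋ'} (F : AInftyMorphism A A')

theorem hasDegree_F : HasDegree (barDegree ℋ) (barDegree ℋ') 0 F.F :=
  HasDegree.zero_iff.mpr F.degree_zero

theorem hasDegree_f₁ : HasDegree ℋ ℋ' 0 F.f₁ := fun i x hx => by
  have h := hasDegree_proj _ _ (F.degree_zero _ _ (hasDegree_ι i x hx))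
  rwa [F.F_ι, proj_ι, add_zero] at h

theorem IsQuasiIso.exists_coneContraction {F : AInftyMorphism A A'} (hF : F.IsQuasiIso) :
    ∃ s : H × H' →ₗ[k] H × H', HasDegree (coneDegree ℋ ℋ') (coneDegree ℋ ℋ') (-1) s ∧
      ∀ x, coneDifferential A.m₁ A'.m₁ F.f₁ (s x) + s (coneDifferential A.m₁ A'.m₁ F.f₁ x) = x := by
  refine exists_cone_contraction A.hasDegree_m₁ A'.hasDegree_m₁ F.hasDegree_f₁ A.m₁_m₁ A'.m₁_m₁
    F.f₁_m₁ (fun v w hv hvw => ?_) fun w hw => ?_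
  · exact (Submodule.Quotient.mk_eq_zero _).mp ((injective_iff_map_eq_zero _).mp hF.1
      (Submodule.Quotient.mk ⟨v, hv⟩) ((Submodule.Quotient.mk_eq_zero _).mpr ⟨w, hvw.symm⟩))
  · obtain ⟨q, hq⟩ := hF.2 (Submodule.Quotient.mk ⟨w, hw⟩)
    obtain ⟨⟨v, hv⟩, rfl⟩ := Submodule.Quotient.mk_surjective _ q
    obtain ⟨w', hw'⟩ := (Submodule.Quotient.eq _).mp hq.symm
    have hw'' : A'.m₁ w' = w - F.f₁ v := hw'
    exact ⟨v, w', hv, by rw [hw'', add_sub_cancel]⟩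

end AInftyMorphism

end Differential

section Perturbation

variable {k : Type*} [Field k] {H : Type*} [AddCommGroup H] [Module k H]
  {H' : Type*} [AddCommGroup H'] [Module k H'] {A : Type*} [Ring A] [Algebra k A]

theorem mul_mul_sub_mem_vanishing {φ χ ψ : Conv k H A} {n : ℕ} (hφ : φ.ofConv 1 = 1)
    (hψ : ψ.ofConv 1 = 1) (hχ : χ.ofConv ∈ vanishing k H A n) :
    (φ * (χ * ψ) - χ).ofConv ∈ vanishing k H A (n + 1) := by
  have one_sub {φ : Conv k H A} (hφ : φ.ofConv 1 = 1) : (φ - 1).ofConv ∈ vanishing k H A 1 :=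
    mem_vanishing_one (by simp [hφ, coalgebra_counit_eq, counit_one])
  have hsplit : φ * (χ * ψ) - χ = (φ - 1) * (χ * ψ) + χ * (ψ - 1) := by noncomm_ring
  rw [hsplit]
  exact add_mem (add_comm n 1 ▸ mul_mem_vanishing (one_sub hφ) (mul_mem_vanishing_left hχ ψ))
    (mul_mem_vanishing hχ (one_sub hψ))

theorem letters_mem_vanishing {a : Bar k H →ₗ[k] H'} {n : ℕ} (ha : a ∈ vanishing k H H' n) :
    (letters a).ofConv ∈ vanishing k H (Bar k H') n := comp_mem_vanishing _ ha

theorem letters_add (a b : Bar k H →ₗ[k] H') : letters (a + b) = letters a + letters b :=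
  congrArg toConv (LinearMap.comp_add _ _ _)

theorem ofLetters_add_sub {a b : Bar k H →ₗ[k] H'} (ha : a 1 = 0) (hb : b 1 = 0) :
    toConv (ofLetters (a + b)) - toConv (ofLetters a) =
      toConv (ofLetters (a + b)) * (letters b * toConv (ofLetters a)) := by
  have hab : (a + b) 1 = 0 := by rw [LinearMap.add_apply, ha, hb, add_zero]
  have hleft : toConv (ofLetters (a + b)) * (1 - letters (a + b)) = 1 :=
    Ring.inverse_mul_cancel _ (isUnit_one_sub_letters hab)
  have hright : (1 - letters a) * toConv (ofLetters a) = 1 :=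
    Ring.mul_inverse_cancel _ (isUnit_one_sub_letters ha)
  have hb' : letters b = (1 - letters a) - (1 - letters (a + b)) := by rw [letters_add]; abel
  rw [hb', sub_mul, mul_sub, ← mul_assoc _ (1 - letters (a + b)), hleft, hright, mul_one, one_mul]

theorem ofLetters_add_sub_mem_vanishing {a b : Bar k H →ₗ[k] H'} {n : ℕ} (ha : a 1 = 0)
    (hb₁ : b 1 = 0) (hb : b ∈ vanishing k H H' n) :
    ofLetters (a + b) - ofLetters a - TensorAlgebra.ι k ∘ₗ b ∈
      vanishing k H (Bar k H') (n + 1) := by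
  have hab : (a + b) 1 = 0 := by rw [LinearMap.add_apply, ha, hb₁, add_zero]
  have h := mul_mul_sub_mem_vanishing (φ := toConv (ofLetters (a + b))) (χ := letters b)
    (ψ := toConv (ofLetters a)) (isCoalgebraMap_ofLetters hab).map_one
    (isCoalgebraMap_ofLetters ha).map_one (letters_mem_vanishing hb)
  rwa [← ofLetters_add_sub ha hb₁] at h

theorem IsCoderivation.sub_letters_mem_vanishing {U V D : Bar k H →ₗ[k] Bar k H'}
    (hD : IsCoderivation U V D) (hU : IsCoalgebraMap U) (hV : IsCoalgebraMap V) {n : ℕ}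
    (h : proj k H' ∘ₗ D ∈ vanishing k H H' n) :
    D - TensorAlgebra.ι k ∘ₗ proj k H' ∘ₗ D ∈ vanishing k H (Bar k H') (n + 1) := by
  have := mul_mul_sub_mem_vanishing (φ := toConv V) (χ := letters (proj k H' ∘ₗ D))
    (ψ := toConv U) hV.map_one hU.map_one (letters_mem_vanishing h)
  rwa [← hD.eq_mul_letters_mul hU hV] at this

end Perturbation

section Candidates

variable {k : Type*} [Field k] {H : Type*} [AddCommGroup H] [Module k H]
  {H' : Type*} [AddCommGroup H'] [Module k H']

/-- The coalgebra map `C(H') → C(H)`, a candidate for the inverse, encoded by the first component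
of `p`. -/
def candidate (p : Bar k H' →ₗ[k] H × H') : Bar k H' →ₗ[k] Bar k H :=
  ofLetters (LinearMap.fst k H H' ∘ₗ p)

variable {p : Bar k H' →ₗ[k] H × H'} (hp : p 1 = 0)
include hp

theorem isCoalgebraMap_candidate : IsCoalgebraMap (candidate p) :=
  isCoalgebraMap_ofLetters (by rw [LinearMap.comp_apply, hp, map_zero])

theorem hasDegree_candidate {ℋ : ℤ → Submodule k H} {ℋ' : ℤ → Submodule k H'}
    (hd : HasDegree (barDegree ℋ') (coneDegree ℋ ℋ') 0 p) :
    HasDegree (barDegree ℋ') (barDegree ℋ) 0 (candidate p) :=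
  hasDegree_ofLetters (by rw [LinearMap.comp_apply, hp, map_zero]) fun i w hw => (hd i w hw).1

theorem candidate_add_sub_mem_vanishing {δ : Bar k H' →ₗ[k] H × H'} {n : ℕ} (hδ₁ : δ 1 = 0)
    (hδ : δ ∈ vanishing k H' (H × H') n) :
    candidate (p + δ) - candidate p - TensorAlgebra.ι k ∘ₗ LinearMap.fst k H H' ∘ₗ δ ∈
      vanishing k H' (Bar k H) (n + 1) := by
  rw [candidate, LinearMap.comp_add]
  exact ofLetters_add_sub_mem_vanishing (by rw [LinearMap.comp_apply, hp, map_zero])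
    (by rw [LinearMap.comp_apply, hδ₁, map_zero]) (comp_mem_vanishing _ hδ)

end Candidates

section CommDefect

variable {k : Type*} [Field k] {H : Type*} [AddCommGroup H] [Module k H]
  {H' : Type*} [AddCommGroup H'] [Module k H']
  {ℋ : ℤ → Submodule k H} [DirectSum.Decomposition ℋ]
  {ℋ' : ℤ → Submodule k H'} [DirectSum.Decomposition ℋ']
  (A : AInftyAlgebra ℋ) (A' : AInftyAlgebra ℋ')

/-- The failure of `candidate p` to commute with the differentials. -/
def commDefect (p : Bar k H' →ₗ[k] H × H') : Bar k H' →ₗ[k] Bar k H :=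
  A.m ∘ₗ candidate p - candidate p ∘ₗ A'.m

variable {p : Bar k H' →ₗ[k] H × H'} (hp : p 1 = 0)
include hp

theorem commDefect_one : commDefect A A' p 1 = 0 := by
  simp [commDefect, (isCoalgebraMap_candidate hp).map_one, A.m_one, A'.m_one]

variable (hd : HasDegree (barDegree ℋ') (coneDegree ℋ ℋ') 0 p)
include hd

theorem hasDegree_commDefect :
    HasDegree (barDegree ℋ') (barDegree ℋ) 1 (commDefect A A' p) := by
  have hG := hasDegree_candidate hp hd
  exact .sub (A.hasDegree_m.comp hG (zero_add 1)) (hG.comp A'.hasDegree_m (add_zero 1))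

theorem isCoderivation_commDefect :
    IsCoderivation (candidate p) (candidate p ∘ₗ barSign ℋ') (commDefect A A' p) := by
  have hG := isCoalgebraMap_candidate hp
  have hleft := A.isCoderivation.comp hG
  have hright := hG.comp_isCoderivation A'.isCoderivation
  rw [LinearMap.id_comp, (hasDegree_candidate hp hd).barSign_comp_of_zero] at hleft
  rw [LinearMap.comp_id] at hright
  exact hleft.sub hright

theorem commDefect_sub_letters_mem_vanishing {n : ℕ}
    (h : proj k H ∘ₗ commDefect A A' p ∈ vanishing k H' H n) :
    commDefect A A' p - TensorAlgebra.ι k ∘ₗ proj k H ∘ₗ commDefect A A' p ∈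
      vanishing k H' (Bar k H) (n + 1) :=
  (isCoderivation_commDefect A A' hp hd).sub_letters_mem_vanishing (isCoalgebraMap_candidate hp)
    ((isCoalgebraMap_candidate hp).comp (isCoalgebraMap_barSign ℋ')) h

end CommDefect

section Homotopy

variable {k : Type*} [Field k] {H : Type*} [AddCommGroup H] [Module k H]
  {H' : Type*} [AddCommGroup H'] [Module k H']

theorem map_anticommutator {M : Type*} [AddCommGroup M] [Module k M] {m S T K : M →ₗ[k] M}
    (hS : S ∘ₗ S = LinearMap.id) (hm : S ∘ₗ m = -(m ∘ₗ S)) (hT : S ∘ₗ T = -(T ∘ₗ S))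
    (hK : S ∘ₗ K = K ∘ₗ S) :
    (TensorProduct.map m LinearMap.id + TensorProduct.map S m) ∘ₗ
        (TensorProduct.map T LinearMap.id + TensorProduct.map (K ∘ₗ S) T) +
      (TensorProduct.map T LinearMap.id + TensorProduct.map (K ∘ₗ S) T) ∘ₗ
        (TensorProduct.map m LinearMap.id + TensorProduct.map S m) =
      TensorProduct.map (m ∘ₗ T + T ∘ₗ m) LinearMap.id + TensorProduct.map K (m ∘ₗ T + T ∘ₗ m) +
        TensorProduct.map ((m ∘ₗ K - K ∘ₗ m) ∘ₗ S) T := by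
  have hS' (x : M) : S (S x) = x := LinearMap.congr_fun hS x
  have hm' (x : M) : S (m x) = -(m (S x)) := LinearMap.congr_fun hm x
  have hT' (x : M) : S (T x) = -(T (S x)) := LinearMap.congr_fun hT x
  have hK' (x : M) : S (K x) = K (S x) := LinearMap.congr_fun hK x
  refine TensorProduct.ext' fun x y => ?_
  simp only [LinearMap.add_apply, LinearMap.comp_apply, LinearMap.sub_apply,
    TensorProduct.map_tmul, LinearMap.id_apply, map_add, hS', hm', hT', hK', map_neg,
    TensorProduct.neg_tmul, TensorProduct.add_tmul, TensorProduct.sub_tmul, TensorProduct.tmul_add]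
  abel

variable {ℋ : ℤ → Submodule k H} [DirectSum.Decomposition ℋ]
  {ℋ' : ℤ → Submodule k H'} [DirectSum.Decomposition ℋ']

theorem hasDegree_barSign : HasDegree (barDegree ℋ) (barDegree ℋ) 0 (barSign ℋ) :=
  HasDegree.zero_iff.mpr fun i w hw => by
    rw [barSign_apply ℋ hw]
    exact Submodule.smul_mem _ _ hw

variable {A : AInftyAlgebra ℋ} {A' : AInftyAlgebra ℋ'}

namespace AInftyMorphism

variable (F : AInftyMorphism A A') (p : Bar k H' →ₗ[k] H × H')

/-- The candidate for a homotopy from the identity to `F ∘ candidate p`, encoded by the second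
component of `p`: a coderivation along these two maps, up to the sign `barSign`. -/
def homotopy : Bar k H' →ₗ[k] Bar k H' :=
  (toConv ((F.F ∘ₗ candidate p) ∘ₗ barSign ℋ') *
    (letters (LinearMap.snd k H H' ∘ₗ p) * toConv LinearMap.id)).ofConv

/-- The failure of `homotopy p` to be a homotopy from the identity to `F ∘ candidate p`. -/
def homotopyDefect : Bar k H' →ₗ[k] Bar k H' :=
  F.F ∘ₗ candidate p - LinearMap.id - (A'.m ∘ₗ F.homotopy p + F.homotopy p ∘ₗ A'.m)

variable {p} (hp : p 1 = 0)
include hp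

theorem isCoalgebraMap_comp_candidate : IsCoalgebraMap (F.F ∘ₗ candidate p) :=
  F.isCoalgebraMap.comp (isCoalgebraMap_candidate hp)

theorem isCoalgebraMap_comp_candidate_comp_barSign :
    IsCoalgebraMap ((F.F ∘ₗ candidate p) ∘ₗ barSign ℋ') :=
  (F.isCoalgebraMap_comp_candidate hp).comp (isCoalgebraMap_barSign ℋ')

theorem isCoderivation_homotopy :
    IsCoderivation LinearMap.id ((F.F ∘ₗ candidate p) ∘ₗ barSign ℋ') (F.homotopy p) :=
  isCoderivation_mul_letters_mul isCoalgebraMap_id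
    (F.isCoalgebraMap_comp_candidate_comp_barSign hp) _

theorem homotopy_one : F.homotopy p 1 = 0 := by
  rw [homotopy, convMul_one, convMul_one]
  simp [letters, hp]

theorem homotopyDefect_one : F.homotopyDefect p 1 = 0 := by
  simp [homotopyDefect, (isCoalgebraMap_candidate hp).map_one, F.F_one, A'.m_one,
    F.homotopy_one hp]

theorem counit_homotopyDefect : counit k H' ∘ₗ F.homotopyDefect p = 0 := by
  have hm : counit k H' ∘ₗ A'.m = 0 :=
    A'.isCoderivation.counit_comp isCoalgebraMap_id (isCoalgebraMap_barSign ℋ')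
  have hT : counit k H' ∘ₗ F.homotopy p = 0 :=
    (F.isCoderivation_homotopy hp).counit_comp isCoalgebraMap_id
      (F.isCoalgebraMap_comp_candidate_comp_barSign hp)
  rw [homotopyDefect, LinearMap.comp_sub, LinearMap.comp_sub, LinearMap.comp_add,
    ← LinearMap.comp_assoc _ A'.m, ← LinearMap.comp_assoc A'.m, hm, hT,
    (F.isCoalgebraMap_comp_candidate hp).counit_comp, LinearMap.comp_id, LinearMap.zero_comp,
    LinearMap.zero_comp, add_zero, sub_self, sub_zero]

section

variable (hd : HasDegree (barDegree ℋ') (coneDegree ℋ ℋ') 0 p)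
include hd

theorem hasDegree_homotopy : HasDegree (barDegree ℋ') (barDegree ℋ') (-1) (F.homotopy p) := by
  have hK : HasDegree (barDegree ℋ') (barDegree ℋ') 0 ((F.F ∘ₗ candidate p) ∘ₗ barSign ℋ') :=
    (F.hasDegree_F.comp (hasDegree_candidate hp hd) (add_zero 0)).comp hasDegree_barSign
      (add_zero 0)
  have ht : HasDegree (barDegree ℋ') ℋ' (-1) (LinearMap.snd k H H' ∘ₗ p) := fun i w hw => by
    simpa [sub_eq_add_neg] using (hd i w hw).2
  exact hasDegree_mul hK (hasDegree_mul (hasDegree_letters ht) .id (add_zero _)) (zero_add _)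

theorem hasDegree_homotopyDefect :
    HasDegree (barDegree ℋ') (barDegree ℋ') 0 (F.homotopyDefect p) := by
  have hT := F.hasDegree_homotopy hp hd
  have hFG : HasDegree (barDegree ℋ') (barDegree ℋ') 0 (F.F ∘ₗ candidate p) :=
    F.hasDegree_F.comp (hasDegree_candidate hp hd) (add_zero 0)
  have hmT : HasDegree (barDegree ℋ') (barDegree ℋ') 0 (A'.m ∘ₗ F.homotopy p) :=
    A'.hasDegree_m.comp hT (neg_add_cancel 1)
  have hTm : HasDegree (barDegree ℋ') (barDegree ℋ') 0 (F.homotopy p ∘ₗ A'.m) :=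
    hT.comp A'.hasDegree_m (add_neg_cancel 1)
  exact (hFG.sub .id).sub (hmT.add hTm)

omit hp hd in
theorem F_comp_commDefect : F.F ∘ₗ commDefect A A' p =
    A'.m ∘ₗ (F.F ∘ₗ candidate p) - (F.F ∘ₗ candidate p) ∘ₗ A'.m := by
  rw [commDefect, LinearMap.comp_sub, ← LinearMap.comp_assoc, F.comm, LinearMap.comp_assoc,
    LinearMap.comp_assoc]

theorem deconc_comp_anticommutator :
    deconc k H' ∘ₗ (A'.m ∘ₗ F.homotopy p + F.homotopy p ∘ₗ A'.m) =
      (TensorProduct.map (A'.m ∘ₗ F.homotopy p + F.homotopy p ∘ₗ A'.m) LinearMap.id +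
        TensorProduct.map (F.F ∘ₗ candidate p)
          (A'.m ∘ₗ F.homotopy p + F.homotopy p ∘ₗ A'.m) +
        TensorProduct.map ((F.F ∘ₗ commDefect A A' p) ∘ₗ barSign ℋ') (F.homotopy p)) ∘ₗ
          deconc k H' := by
  have hFG : HasDegree (barDegree ℋ') (barDegree ℋ') 0 (F.F ∘ₗ candidate p) :=
    F.hasDegree_F.comp (hasDegree_candidate hp hd) (add_zero 0)
  have hST : barSign ℋ' ∘ₗ F.homotopy p = -(F.homotopy p ∘ₗ barSign ℋ') := by
    rw [(F.hasDegree_homotopy hp hd).barSign_comp]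
    ext
    simp
  have hT : deconc k H' ∘ₗ F.homotopy p = (TensorProduct.map (F.homotopy p) LinearMap.id +
      TensorProduct.map ((F.F ∘ₗ candidate p) ∘ₗ barSign ℋ') (F.homotopy p)) ∘ₗ deconc k H' := by
    rw [F.isCoderivation_homotopy hp, LinearMap.add_comp]
  have hm : deconc k H' ∘ₗ A'.m = (TensorProduct.map A'.m LinearMap.id +
      TensorProduct.map (barSign ℋ') A'.m) ∘ₗ deconc k H' := by
    rw [A'.isCoderivation, LinearMap.add_comp]
  rw [F.F_comp_commDefect, ← map_anticommutator
    (barSign_comp_barSign ℋ') A'.barSign_comp_m hST hFG.barSign_comp_of_zero, LinearMap.comp_add,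
    ← LinearMap.comp_assoc, ← LinearMap.comp_assoc, hm, hT, LinearMap.comp_assoc,
    LinearMap.comp_assoc, hm, hT, ← LinearMap.comp_assoc, ← LinearMap.comp_assoc,
    LinearMap.add_comp (deconc k H')]

theorem deconc_comp_homotopyDefect :
    deconc k H' ∘ₗ F.homotopyDefect p =
      (TensorProduct.map (F.homotopyDefect p) LinearMap.id -
        TensorProduct.map ((F.F ∘ₗ commDefect A A' p) ∘ₗ barSign ℋ') (F.homotopy p) +
        TensorProduct.map (F.F ∘ₗ candidate p) (F.homotopyDefect p)) ∘ₗ deconc k H' := by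
  have hFG := (F.isCoalgebraMap_comp_candidate hp).comul_comp
  have hanti := F.deconc_comp_anticommutator hp hd
  rw [homotopyDefect, LinearMap.comp_sub, LinearMap.comp_sub, hFG, hanti, LinearMap.comp_id]
  simp only [map_sub_left, map_sub_right, LinearMap.add_comp, LinearMap.sub_comp,
    TensorProduct.map_id, LinearMap.id_comp]
  abel

end

end AInftyMorphism

end Homotopy

section Defect

variable {k : Type*} [Field k] {H : Type*} [AddCommGroup H] [Module k H]
  {H' : Type*} [AddCommGroup H'] [Module k H']
  {ℋ : ℤ → Submodule k H} [DirectSum.Decomposition ℋ]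
  {ℋ' : ℤ → Submodule k H'} [DirectSum.Decomposition ℋ']
  {A : AInftyAlgebra ℋ} {A' : AInftyAlgebra ℋ'}

theorem mem_vanishing_of_sub_mem {M : Type*} [AddCommGroup M] [Module k M]
    {φ ψ : Bar k H →ₗ[k] M} {n : ℕ} (h : φ - ψ ∈ vanishing k H M (n + 1))
    (hψ : ψ ∈ vanishing k H M n) : φ ∈ vanishing k H M n :=
  sub_add_cancel φ ψ ▸ add_mem (vanishing_antitone n.le_succ h) hψ

namespace AInftyMorphism

variable (F : AInftyMorphism A A') (p : Bar k H' →ₗ[k] H × H')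

/-- The letter components of the two defects, as a map to the mapping cone of `f₁`. -/
def defect : Bar k H' →ₗ[k] H × H' :=
  (proj k H ∘ₗ commDefect A A' p).prod (proj k H' ∘ₗ F.homotopyDefect p)

variable {p} (hp : p 1 = 0)
include hp

theorem defect_one : F.defect p 1 = 0 := by
  simp [defect, commDefect_one A A' hp, F.homotopyDefect_one hp]

variable (hd : HasDegree (barDegree ℋ') (coneDegree ℋ ℋ') 0 p)
include hd

theorem hasDegree_defect : HasDegree (barDegree ℋ') (coneDegree ℋ ℋ') 1 (F.defect p) := by
  have hc : HasDegree (barDegree ℋ') ℋ 1 (proj k H ∘ₗ commDefect A A' p) :=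
    hasDegree_proj.comp (hasDegree_commDefect A A' hp hd) (add_zero 1)
  have hh : HasDegree (barDegree ℋ') ℋ' 0 (proj k H' ∘ₗ F.homotopyDefect p) :=
    hasDegree_proj.comp (F.hasDegree_homotopyDefect hp hd) (add_zero 0)
  exact fun i w hw => ⟨hc i w hw, by simpa using! hh i w hw⟩

theorem homotopyDefect_eq : toConv (F.homotopyDefect p) = toConv (F.F ∘ₗ candidate p) *
    (letters (proj k H' ∘ₗ F.homotopyDefect p) * toConv LinearMap.id -
      letters (proj k H' ∘ₗ (F.F ∘ₗ commDefect A A' p) ∘ₗ barSign ℋ') *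
        toConv (F.homotopy p)) := by
  have hΔ : toConv (deconc k H' ∘ₗ F.homotopyDefect p) =
      inl (toConv (F.homotopyDefect p)) * inr (toConv LinearMap.id) -
        inl (toConv ((F.F ∘ₗ commDefect A A' p) ∘ₗ barSign ℋ')) * inr (toConv (F.homotopy p)) +
      inl (toConv (F.F ∘ₗ candidate p)) * inr (toConv (F.homotopyDefect p)) := by
    rw [F.deconc_comp_homotopyDefect hp hd, ← map_deconc, ← map_deconc, ← map_deconc]
    rfl
  rw [(F.isCoalgebraMap_comp_candidate hp).eq_mul_firstLetter (F.counit_homotopyDefect hp) hΔ,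
    ← firstLetter_inl_mul_inr, ← firstLetter_inl_mul_inr]
  exact congrArg (fun φ => _ * toConv φ) (LinearMap.comp_sub _ _ _)

section

variable {n : ℕ} (h : F.defect p ∈ vanishing k H' (H × H') n)
include h

theorem commDefect_sub_mem_vanishing :
    commDefect A A' p - TensorAlgebra.ι k ∘ₗ LinearMap.fst k H H' ∘ₗ F.defect p ∈
      vanishing k H' (Bar k H) (n + 1) :=
  commDefect_sub_letters_mem_vanishing A A' hp hd (comp_mem_vanishing (LinearMap.fst k H H') h)

theorem homotopyDefect_sub_mem_vanishing :
    F.homotopyDefect p - TensorAlgebra.ι k ∘ₗ LinearMap.snd k H H' ∘ₗ F.defect p ∈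
      vanishing k H' (Bar k H') (n + 1) := by
  have hc : commDefect A A' p ∈ vanishing k H' (Bar k H) n :=
    mem_vanishing_of_sub_mem (F.commDefect_sub_mem_vanishing hp hd h)
      (comp_mem_vanishing _ (comp_mem_vanishing _ h))
  have hmain := mul_mul_sub_mem_vanishing (φ := toConv (F.F ∘ₗ candidate p))
    (χ := letters (proj k H' ∘ₗ F.homotopyDefect p)) (ψ := toConv LinearMap.id)
    (F.isCoalgebraMap_comp_candidate hp).map_one rfl
    (letters_mem_vanishing (comp_mem_vanishing (LinearMap.snd k H H') h))
  have herror := mul_mem_vanishing_right (toConv (F.F ∘ₗ candidate p)) (mul_mem_vanishing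
    (φ := letters (proj k H' ∘ₗ (F.F ∘ₗ commDefect A A' p) ∘ₗ barSign ℋ'))
    (ψ := toConv (F.homotopy p)) (letters_mem_vanishing (comp_mem_vanishing _
      (preservesLength_barSign.comp_mem_vanishing (comp_mem_vanishing _ hc))))
    (mem_vanishing_one (F.homotopy_one hp)))
  have hsum := sub_mem hmain herror
  rwa [← ofConv_sub, sub_right_comm, ← mul_sub, ← F.homotopyDefect_eq hp hd] at hsum

theorem coneDifferential_defect {w : Bar k H'} (hw : w ∈ lengthLT k H' (n + 1)) :
    coneDifferential A.m₁ A'.m₁ F.f₁ (F.defect p w) = -F.defect p (A'.m w) := by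
  have hmw := A'.preservesLength_m _ w hw
  have hc {w} (hw : w ∈ lengthLT k H' (n + 1)) :
      commDefect A A' p w = TensorAlgebra.ι k (F.defect p w).1 :=
    sub_eq_zero.mp (F.commDefect_sub_mem_vanishing hp hd h w hw)
  have hh {w} (hw : w ∈ lengthLT k H' (n + 1)) :
      F.homotopyDefect p w = TensorAlgebra.ι k (F.defect p w).2 :=
    sub_eq_zero.mp (F.homotopyDefect_sub_mem_vanishing hp hd h w hw)
  have hcycle : A.m (commDefect A A' p w) = -commDefect A A' p (A'.m w) := by
    have hm : A.m (A.m (candidate p w)) = 0 := LinearMap.congr_fun A.sq_zero _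
    have hm' : A'.m (A'.m w) = 0 := LinearMap.congr_fun A'.sq_zero w
    simp [commDefect, hm, hm']
  have hcycle' : F.F (commDefect A A' p w) - A'.m (F.homotopyDefect p w) =
      -F.homotopyDefect p (A'.m w) := by
    have hm' (w) : A'.m (A'.m w) = 0 := LinearMap.congr_fun A'.sq_zero w
    have hF (w) : F.F (A.m w) = A'.m (F.F w) := LinearMap.congr_fun F.comm w
    simp only [commDefect, homotopyDefect, LinearMap.sub_apply, LinearMap.add_apply,
      LinearMap.comp_apply, LinearMap.id_apply, map_sub, map_add, hm', hF, map_zero]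
    abel
  rw [hc hw, hc hmw, A.m_ι, ← map_neg] at hcycle
  rw [hc hw, hh hw, hh hmw, A'.m_ι, F.F_ι, ← map_sub, ← map_neg] at hcycle'
  rw [coneDifferential_apply]
  exact Prod.ext ((TensorAlgebra.ι_inj k _ _).mp hcycle) ((TensorAlgebra.ι_inj k _ _).mp hcycle')

end

end AInftyMorphism

end Defect

section Correction

variable {k : Type*} [Field k] {H : Type*} [AddCommGroup H] [Module k H]
  {H' : Type*} [AddCommGroup H'] [Module k H']
  {ℋ : ℤ → Submodule k H} [DirectSum.Decomposition ℋ]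
  {ℋ' : ℤ → Submodule k H'} [DirectSum.Decomposition ℋ']
  {A : AInftyAlgebra ℋ} {A' : AInftyAlgebra ℋ'}

namespace AInftyMorphism

variable (F : AInftyMorphism A A') {p δ : Bar k H' →ₗ[k] H × H'}

section

variable {n : ℕ} (hp : p 1 = 0) (hδ₁ : δ 1 = 0) (hδ : δ ∈ vanishing k H' (H × H') n)
include hp hδ₁ hδ

theorem homotopy_add_sub_mem_vanishing :
    F.homotopy (p + δ) - F.homotopy p - TensorAlgebra.ι k ∘ₗ LinearMap.snd k H H' ∘ₗ δ ∈
      vanishing k H' (Bar k H') (n + 1) := by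
  have hpδ : (p + δ) 1 = 0 := by rw [LinearMap.add_apply, hp, hδ₁, add_zero]
  have hG : candidate (p + δ) - candidate p ∈ vanishing k H' (Bar k H) n :=
    mem_vanishing_of_sub_mem (candidate_add_sub_mem_vanishing hp hδ₁ hδ)
      (comp_mem_vanishing _ (comp_mem_vanishing _ hδ))
  have hK : (F.F ∘ₗ candidate (p + δ)) ∘ₗ barSign ℋ' - (F.F ∘ₗ candidate p) ∘ₗ barSign ℋ' ∈
      vanishing k H' (Bar k H') n := by
    rw [← LinearMap.sub_comp, ← LinearMap.comp_sub]
    exact preservesLength_barSign.comp_mem_vanishing (comp_mem_vanishing _ hG)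
  have hmain := mul_mul_sub_mem_vanishing
    (φ := toConv ((F.F ∘ₗ candidate (p + δ)) ∘ₗ barSign ℋ'))
    (χ := letters (LinearMap.snd k H H' ∘ₗ δ)) (ψ := toConv LinearMap.id)
    (F.isCoalgebraMap_comp_candidate_comp_barSign hpδ).map_one rfl
    (letters_mem_vanishing (comp_mem_vanishing _ hδ))
  have herror := mul_mem_vanishing (φ := toConv ((F.F ∘ₗ candidate (p + δ)) ∘ₗ barSign ℋ') -
      toConv ((F.F ∘ₗ candidate p) ∘ₗ barSign ℋ'))
    (ψ := letters (LinearMap.snd k H H' ∘ₗ p) * toConv LinearMap.id) hK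
    (mem_vanishing_one (by rw [convMul_one]; simp [letters, hp]))
  have hsplit (φ φ' σ τ ψ : Conv k H' (Bar k H')) :
      (φ * ((σ + τ) * ψ) - φ' * (σ * ψ) - τ).ofConv =
        (φ * (τ * ψ) - τ).ofConv + ((φ - φ') * (σ * ψ)).ofConv := by
    refine congrArg ofConv (a₂ := φ * (τ * ψ) - τ + (φ - φ') * (σ * ψ)) ?_
    noncomm_ring
  have hsum := add_mem hmain herror
  rwa [← hsplit, ← letters_add, ← LinearMap.comp_add] at hsum

theorem defect_add {w : Bar k H'} (hw : w ∈ lengthLT k H' (n + 1)) :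
    F.defect (p + δ) w =
      F.defect p w + coneDifferential A.m₁ A'.m₁ F.f₁ (δ w) - δ (A'.m w) := by
  have hmw := A'.preservesLength_m _ w hw
  have hG {w} (hw : w ∈ lengthLT k H' (n + 1)) :
      candidate (p + δ) w = candidate p w + TensorAlgebra.ι k (δ w).1 :=
    sub_eq_iff_eq_add'.mp (sub_eq_zero.mp (candidate_add_sub_mem_vanishing hp hδ₁ hδ w hw))
  have hT {w} (hw : w ∈ lengthLT k H' (n + 1)) :
      F.homotopy (p + δ) w = F.homotopy p w + TensorAlgebra.ι k (δ w).2 :=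
    sub_eq_iff_eq_add'.mp (sub_eq_zero.mp (F.homotopy_add_sub_mem_vanishing hp hδ₁ hδ w hw))
  refine Prod.ext ?_ ?_
  · change proj k H (A.m (candidate (p + δ) w) - candidate (p + δ) (A'.m w)) =
      proj k H (A.m (candidate p w) - candidate p (A'.m w)) + A.m₁ (δ w).1 - (δ (A'.m w)).1
    rw [hG hw, hG hmw]
    simp only [map_add, map_sub, A.m_ι, proj_ι]
    abel
  · change proj k H' (F.F (candidate (p + δ) w) - w -
        (A'.m (F.homotopy (p + δ) w) + F.homotopy (p + δ) (A'.m w))) =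
      proj k H' (F.F (candidate p w) - w - (A'.m (F.homotopy p w) + F.homotopy p (A'.m w))) +
        (F.f₁ (δ w).1 - A'.m₁ (δ w).2) - (δ (A'.m w)).2
    rw [hG hw, hT hw, hT hmw]
    simp only [map_add, map_sub, A'.m_ι, F.F_ι, proj_ι]
    abel

end

variable {s : H × H' →ₗ[k] H × H'}
  (hs : ∀ x, coneDifferential A.m₁ A'.m₁ F.f₁ (s x) + s (coneDifferential A.m₁ A'.m₁ F.f₁ x) = x)
  (hp : p 1 = 0) (hd : HasDegree (barDegree ℋ') (coneDegree ℋ ℋ') 0 p)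

include hs hp hd in
theorem defect_sub_contraction_mem_vanishing {n : ℕ}
    (h : F.defect p ∈ vanishing k H' (H × H') n) :
    F.defect (p - s ∘ₗ F.defect p) ∈ vanishing k H' (H × H') (n + 1) := fun w hw => by
  have hδ₁ : (-(s ∘ₗ F.defect p)) 1 = 0 := by simp [F.defect_one hp]
  rw [sub_eq_add_neg, F.defect_add hp hδ₁ (neg_mem (comp_mem_vanishing s h)) hw]
  have hsD := hs (F.defect p w)
  rw [F.coneDifferential_defect hp hd h hw, map_neg, ← sub_eq_add_neg] at hsD
  simp only [LinearMap.neg_apply, LinearMap.comp_apply, map_neg]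
  rw [sub_neg_eq_add, ← sub_eq_add_neg, sub_add, hsD, sub_self]

end AInftyMorphism

end Correction

section Inverse

variable {k : Type*} [Field k] {H : Type*} [AddCommGroup H] [Module k H]
  {H' : Type*} [AddCommGroup H'] [Module k H']
  {ℋ : ℤ → Submodule k H} [DirectSum.Decomposition ℋ]
  {ℋ' : ℤ → Submodule k H'} [DirectSum.Decomposition ℋ']
  {A : AInftyAlgebra ℋ} {A' : AInftyAlgebra ℋ'}

namespace AInftyMorphism

variable (F : AInftyMorphism A A')

/-- The successive corrections of the zero candidate by a contraction `s` of the mapping cone. -/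
def approximant (s : H × H' →ₗ[k] H × H') : ℕ → (Bar k H' →ₗ[k] H × H')
  | 0 => 0
  | n + 1 => approximant s n - s ∘ₗ F.defect (approximant s n)

section

variable {s : H × H' →ₗ[k] H × H'}

theorem approximant_one (n : ℕ) : F.approximant s n 1 = 0 := by
  induction n with
  | zero => rfl
  | succ n ih => simp [approximant, ih, F.defect_one ih]

variable (hsd : HasDegree (coneDegree ℋ ℋ') (coneDegree ℋ ℋ') (-1) s)
include hsd

theorem hasDegree_approximant (n : ℕ) :
    HasDegree (barDegree ℋ') (coneDegree ℋ ℋ') 0 (F.approximant s n) := by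
  induction n with
  | zero => exact fun _ _ _ => zero_mem _
  | succ n ih =>
    exact ih.sub (hsd.comp (F.hasDegree_defect (F.approximant_one n) ih) (add_neg_cancel 1))

variable
  (hs : ∀ x, coneDifferential A.m₁ A'.m₁ F.f₁ (s x) + s (coneDifferential A.m₁ A'.m₁ F.f₁ x) = x)
include hs

theorem defect_approximant_mem_vanishing (n : ℕ) :
    F.defect (F.approximant s n) ∈ vanishing k H' (H × H') n := by
  induction n with
  | zero => exact mem_vanishing_zero _
  | succ n ih =>
    exact F.defect_sub_contraction_mem_vanishing hs (F.approximant_one n)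
      (F.hasDegree_approximant hsd n) ih

theorem exists_defect_eq_zero : ∃ p : Bar k H' →ₗ[k] H × H',
    p 1 = 0 ∧ HasDegree (barDegree ℋ') (coneDegree ℋ ℋ') 0 p ∧ F.defect p = 0 := by
  have hdefect := F.defect_approximant_mem_vanishing hsd hs
  obtain ⟨p, hp⟩ := exists_limit_of_stable (F.approximant s) fun n w hw => by
    simp [approximant, hdefect n w hw]
  have happrox (n : ℕ) : p - F.approximant s n ∈ vanishing k H' (H × H') n :=
    fun w hw => sub_eq_zero.mpr (hp n w hw)
  have hp₁ : p 1 = 0 :=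
    (hp 1 1 (word_mem_lengthLT (l := []) one_pos)).trans (F.approximant_one 1)
  refine ⟨p, hp₁, .of_approx fun n => ⟨_, F.hasDegree_approximant hsd n, happrox n⟩,
    eq_zero_of_forall_mem_vanishing fun n w hw => ?_⟩
  have hδ₁ : (p - F.approximant s n) 1 = 0 := by simp [hp₁, F.approximant_one n]
  have h := F.defect_add (p := F.approximant s n) (F.approximant_one n) hδ₁ (happrox n)
    (lengthLT_mono n.le_succ hw)
  rw [add_sub_cancel] at h
  rw [h, hdefect n w hw, happrox n w hw, happrox n _ (A'.preservesLength_m n w hw)]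
  simp

end

section

variable {p : Bar k H' →ₗ[k] H × H'} (hp : p 1 = 0)
  (hd : HasDegree (barDegree ℋ') (coneDegree ℋ ℋ') 0 p) (h : F.defect p = 0)
include hp hd h

theorem commDefect_eq_zero : commDefect A A' p = 0 :=
  eq_zero_of_forall_mem_vanishing fun n => by
    have hn : F.defect p ∈ vanishing k H' (H × H') n := h ▸ zero_mem _
    exact mem_vanishing_of_sub_mem (F.commDefect_sub_mem_vanishing hp hd hn)
      (comp_mem_vanishing _ (comp_mem_vanishing _ hn))

theorem homotopyDefect_eq_zero : F.homotopyDefect p = 0 :=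
  eq_zero_of_forall_mem_vanishing fun n => by
    have hn : F.defect p ∈ vanishing k H' (H × H') n := h ▸ zero_mem _
    exact mem_vanishing_of_sub_mem (F.homotopyDefect_sub_mem_vanishing hp hd hn)
      (comp_mem_vanishing _ (comp_mem_vanishing _ hn))

/-- The `A∞`-morphism given by a candidate whose defect vanishes. -/
def ofDefectEqZero : AInftyMorphism A' A where
  F := candidate p
  degree_zero := HasDegree.zero_iff.mp (hasDegree_candidate hp hd)
  comul_comp := (isCoalgebraMap_candidate hp).comul_comp
  counit_comp := (isCoalgebraMap_candidate hp).counit_comp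
  comm := (sub_eq_zero.mp (F.commDefect_eq_zero hp hd h)).symm
  f_zero := by
    ext v
    simp [component, TensorAlgebra.tprod_apply, (isCoalgebraMap_candidate hp).map_one, proj_one]

end

theorem homotopy_ι {p : Bar k H' →ₗ[k] H × H'} (hp : p 1 = 0) (x : H') :
    F.homotopy p (TensorAlgebra.ι k x) =
      TensorAlgebra.ι k (p (TensorAlgebra.ι k x)).2 := by
  have h := mul_mul_sub_mem_vanishing
    (φ := toConv ((F.F ∘ₗ candidate p) ∘ₗ barSign ℋ')) (χ := letters (LinearMap.snd k H H' ∘ₗ p))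
    (ψ := toConv LinearMap.id) (F.isCoalgebraMap_comp_candidate_comp_barSign hp).map_one rfl
    (letters_mem_vanishing (comp_mem_vanishing _ (mem_vanishing_one hp)))
  exact sub_eq_zero.mp (h _ (ι_mem_lengthLT x))

variable {F}

theorem IsQuasiIso.exists_homotopy_inverse (hF : F.IsQuasiIso) :
    ∃ (G : AInftyMorphism A' A) (t : H' →ₗ[k] H'),
      ∀ x, F.f₁ (G.f₁ x) = x + (A'.m₁ (t x) + t (A'.m₁ x)) := by
  obtain ⟨s, hsd, hs⟩ := hF.exists_coneContraction
  obtain ⟨p, hp, hd, hdefect⟩ := F.exists_defect_eq_zero hsd hs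
  let G := F.ofDefectEqZero hp hd hdefect
  refine ⟨G, LinearMap.snd k H H' ∘ₗ p ∘ₗ TensorAlgebra.ι k, fun x => ?_⟩
  have hG : candidate p (TensorAlgebra.ι k x) = TensorAlgebra.ι k (G.f₁ x) := G.F_ι x
  have h := LinearMap.congr_fun (F.homotopyDefect_eq_zero hp hd hdefect) (TensorAlgebra.ι k x)
  simp only [homotopyDefect, LinearMap.sub_apply, LinearMap.add_apply, LinearMap.comp_apply,
    LinearMap.id_apply, LinearMap.zero_apply, A'.m_ι, F.homotopy_ι hp, hG, F.F_ι, ← map_sub,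
    ← map_add, TensorAlgebra.ι_eq_zero_iff] at h
  rwa [sub_sub, sub_eq_zero] at h

theorem cohomologyMap_comp_eq_id {G : AInftyMorphism A' A} {t : H' →ₗ[k] H'}
    (h : ∀ x, F.f₁ (G.f₁ x) = x + (A'.m₁ (t x) + t (A'.m₁ x))) :
    F.cohomologyMap ∘ₗ G.cohomologyMap = LinearMap.id := by
  refine LinearMap.ext fun q => ?_
  obtain ⟨⟨x, hx⟩, rfl⟩ := Submodule.Quotient.mk_surjective _ q
  refine (Submodule.Quotient.eq _).mpr ⟨t x, ?_⟩
  change A'.m₁ (t x) = F.f₁ (G.f₁ x) - x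
  rw [h, LinearMap.mem_ker.mp hx, map_zero, add_zero, add_sub_cancel_left]

end AInftyMorphism

end Inverse

end AInfty

end

theorem theorem4p11_general {k : Type*} [Field k]
    {H : Type*} [AddCommGroup H] [Module k H] (ℋ : ℤ → Submodule k H) [DirectSum.Decomposition ℋ]
    {H' : Type*} [AddCommGroup H'] [Module k H'] (ℋ' : ℤ → Submodule k H')
    [DirectSum.Decomposition ℋ']
    (A : AInfty.AInftyAlgebra ℋ) (A' : AInfty.AInftyAlgebra ℋ')
    (F : AInfty.AInftyMorphism A A') (hF : F.IsQuasiIso) :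
    ∃ G : AInfty.AInftyMorphism A' A, G.IsQuasiIso ∧
      G.cohomologyMap ∘ₗ F.cohomologyMap = LinearMap.id ∧
      F.cohomologyMap ∘ₗ G.cohomologyMap = LinearMap.id := by
  obtain ⟨G, t, ht⟩ := hF.exists_homotopy_inverse
  have hFG : F.cohomologyMap ∘ₗ G.cohomologyMap = LinearMap.id :=
    AInfty.AInftyMorphism.cohomologyMap_comp_eq_id ht
  have hGF : G.cohomologyMap ∘ₗ F.cohomologyMap = LinearMap.id :=
    LinearMap.ext fun q => hF.injective (LinearMap.congr_fun hFG (F.cohomologyMap q))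
  exact ⟨G, Function.bijective_iff_has_inverse.mpr
    ⟨F.cohomologyMap, LinearMap.congr_fun hFG, LinearMap.congr_fun hGF⟩, hGF, hFG⟩

theorem theorem4p11 {k : Type*} [Field k] [CharZero k]
    {H : Type*} [AddCommGroup H] [Module k H] (ℋ : ℤ → Submodule k H) [DirectSum.Decomposition ℋ]
    {H' : Type*} [AddCommGroup H'] [Module k H'] (ℋ' : ℤ → Submodule k H')
    [DirectSum.Decomposition ℋ']
    (A : AInfty.AInftyAlgebra ℋ) (A' : AInfty.AInftyAlgebra ℋ')
    (F : AInfty.AInftyMorphism A A') (hF : F.IsQuasiIso) :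
    ∃ G : AInfty.AInftyMorphism A' A, G.IsQuasiIso ∧
      G.cohomologyMap ∘ₗ F.cohomologyMap = LinearMap.id ∧
      F.cohomologyMap ∘ₗ G.cohomologyMap = LinearMap.id :=
  theorem4p11_general ℋ ℋ' A A' F hF
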